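/- An instance of \textsc{Vertex-Disjoint Paths} (VDP) consists of a finite simple undirected graph $G$ and an ordered multiset $\mathcal{X}=\{(s_1,t_1),\ldots,(s_k,t_k)\}$ of $k$ pairs of distinct vertices of $G$ (a pair may occur several times, and pairs may share vertices). It is a Yes-instance if $G$ contains $k$ distinct paths $P_1,\ldots,P_k$ such that $P_i$ has endpoints $s_i$ and $t_i$ for every $i$, and such that for all $i\neq j$ no internal vertex of $P_i$ is a vertex of $P_j$. A graph is a split graph if its vertex set can be partitioned into a clique and an independent set (either may be empty). \textbf{Theorem.} VDP on split graphs, parameterized by the number $k$ of occurrences of terminal pairs, admits a kernel with at most $4k$ vertices. That is, there is an algorithm that, given any VDP instance $(G,\mathcal{X},k)$ in which $G$ is a split graph, computes in time polynomial in $|V(G)|+k$ a VDP instance $(G',\mathcal{X}',k')$ such that 1. $G'$ is a split graph, 2. $(G,\mathcal{X},k)$ is a Yes-instance if and only if $(G',\mathcal{X}',k')$ is a Yes-instance, 3. $|V(G')|\le 4k$ and $k'\le k$, and 4. if $G$ is connected, then so is $G'$ (where the graph without vertices counts as connected). -/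

import Mathlib

/-! ### Split graphs, internally vertex-disjoint paths, and the problem -/

/-- A split graph: the vertex set is partitioned into a clique `C` and an independent set. -/
def IsSplitGraph {V : Type*} (G : SimpleGraph V) : Prop :=
  ∃ C : Set V, G.IsClique C ∧ G.IsIndepSet Cᶜ

/-- No internal vertex of one of the two paths is a vertex of the other one. -/
def InternallyVertexDisjoint {V : Type*} {G : SimpleGraph V} {s₁ t₁ s₂ t₂ : V}
    (p : G.Walk s₁ t₁) (q : G.Walk s₂ t₂) : Prop :=
  (∀ v ∈ p.support, v ≠ s₁ → v ≠ t₁ → v ∉ q.support) ∧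
  (∀ v ∈ q.support, v ≠ s₂ → v ≠ t₂ → v ∉ p.support)

/-- An instance of Vertex-Disjoint Paths: a finite simple graph (with vertices numbered
`0, …, n - 1`) and an ordered multiset of `k` pairs of distinct vertices. A pair may occur
several times, and pairs may share vertices. -/
structure VDPInstance where
  /-- the number of vertices -/
  n : ℕ
  /-- the graph -/
  G : SimpleGraph (Fin n)
  /-- the number of occurrences of terminal pairs (the parameter) -/
  k : ℕ
  /-- the first terminal of each pair -/
  s : Fin k → Fin n
  /-- the second terminal of each pair -/
  t : Fin k → Fin n
  /-- the two terminals of a pair are distinct -/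
  s_ne_t : ∀ i, s i ≠ t i

/-- The instance is a Yes-instance: there are `k` distinct and pairwise internally
vertex-disjoint paths, the `i`-th one joining `s i` and `t i`. Paths are undirected, so they are
compared as subgraphs: a path and its reversal are the same path. -/
def VDPInstance.IsYes (I : VDPInstance) : Prop :=
  ∃ P : ∀ i : Fin I.k, I.G.Path (I.s i) (I.t i), ∀ i j : Fin I.k, i ≠ j →
    (P i : I.G.Walk (I.s i) (I.t i)).toSubgraph ≠ (P j : I.G.Walk (I.s j) (I.t j)).toSubgraph ∧
    InternallyVertexDisjoint (P i : I.G.Walk (I.s i) (I.t i)) (P j : I.G.Walk (I.s j) (I.t j))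

/-! ### Random access machines

Structured programs for a random access machine whose memory consists of registers and of
two-dimensional arrays of natural numbers. The only arithmetic operations are addition and
truncated subtraction, so that the bit length of the numbers grows by at most a constant in each
step, and unit cost measures polynomial time correctly. -/

namespace RAM

/-- A memory configuration: register `x` holds `reg x`, and `arr a i j` is the entry with
indices `i`, `j` of the array `a`. -/
structure State where
  /-- the registers -/
  reg : ℕ → ℕ
  /-- the arrays -/
  arr : ℕ → ℕ → ℕ → ℕ

/-- Arithmetic expressions. -/
inductive Term where
  | const (c : ℕ)
  | reg (x : ℕ)
  | read (a : ℕ) (i j : Term)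
  | add (e f : Term)
  | sub (e f : Term)
  | eq (e f : Term)
  | lt (e f : Term)

/-- The value of an expression; the value of a comparison is `1` or `0`. -/
def Term.eval (σ : State) : Term → ℕ
  | const c => c
  | reg x => σ.reg x
  | read a i j => σ.arr a (i.eval σ) (j.eval σ)
  | add e f => e.eval σ + f.eval σ
  | sub e f => e.eval σ - f.eval σ
  | eq e f => if e.eval σ = f.eval σ then 1 else 0
  | lt e f => if e.eval σ < f.eval σ then 1 else 0

/-- Set register `x` to `v`. -/
def State.setReg (σ : State) (x v : ℕ) : State where
  reg y := if y = x then v else σ.reg y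
  arr := σ.arr

/-- Set the entry with indices `i`, `j` of the array `a` to `v`. -/
def State.setArr (σ : State) (a i j v : ℕ) : State where
  reg := σ.reg
  arr b i' j' := if b = a ∧ i' = i ∧ j' = j then v else σ.arr b i' j'

/-- Programs. -/
inductive Prog where
  | skip
  | assign (x : ℕ) (e : Term)
  | write (a : ℕ) (i j e : Term)
  | seq (c d : Prog)
  | ite (e : Term) (c d : Prog)
  | loop (e : Term) (c : Prog)

/-- `Runs c σ τ T`: started in `σ`, the program `c` halts in `τ` after `T` steps. Each
assignment and each evaluation of a test counts as one step; a test succeeds if its value is not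
zero, and `loop e c` repeats `c` as long as the test `e` succeeds. -/
inductive Runs : Prog → State → State → ℕ → Prop where
  | skip (σ : State) : Runs .skip σ σ 1
  | assign (σ : State) (x : ℕ) (e : Term) :
      Runs (.assign x e) σ (σ.setReg x (e.eval σ)) 1
  | write (σ : State) (a : ℕ) (i j e : Term) :
      Runs (.write a i j e) σ (σ.setArr a (i.eval σ) (j.eval σ) (e.eval σ)) 1
  | seq {c d : Prog} {σ τ υ : State} {S T : ℕ} :
      Runs c σ τ S → Runs d τ υ T → Runs (.seq c d) σ υ (S + T)
  | ite_pos {e : Term} {c d : Prog} {σ τ : State} {T : ℕ} :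
      e.eval σ ≠ 0 → Runs c σ τ T → Runs (.ite e c d) σ τ (T + 1)
  | ite_neg {e : Term} {c d : Prog} {σ τ : State} {T : ℕ} :
      e.eval σ = 0 → Runs d σ τ T → Runs (.ite e c d) σ τ (T + 1)
  | loop_stop {e : Term} {c : Prog} {σ : State} :
      e.eval σ = 0 → Runs (.loop e c) σ σ 1
  | loop_step {e : Term} {c : Prog} {σ τ υ : State} {S T : ℕ} :
      e.eval σ ≠ 0 → Runs c σ τ S → Runs (.loop e c) τ υ T →
      Runs (.loop e c) σ υ (S + T + 1)

end RAM

/-! ### Instances in the memory of the machine -/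

open Classical in
/-- The initial memory on input `I`: the numbers `n` and `k` in the registers `0` and `1`, the
adjacency matrix in array `0`, the terminal pairs in the rows of array `1`, and `0` elsewhere. -/
noncomputable def VDPInstance.inputState (I : VDPInstance) : RAM.State where
  reg x := if x = 0 then I.n else if x = 1 then I.k else 0
  arr a i j :=
    if a = 0 then
      if ∃ (hi : i < I.n) (hj : j < I.n), I.G.Adj ⟨i, hi⟩ ⟨j, hj⟩ then 1 else 0
    else if a = 1 then
      if hi : i < I.k then
        if j = 0 then I.s ⟨i, hi⟩ else if j = 1 then I.t ⟨i, hi⟩ else 0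
      else 0
    else 0

/-- The memory `σ` holds the instance `J`, in the same format; other memory cells are ignored. -/
def VDPInstance.IsOutput (J : VDPInstance) (σ : RAM.State) : Prop :=
  σ.reg 0 = J.n ∧ σ.reg 1 = J.k ∧
  (∀ u v : Fin J.n, (J.G.Adj u v → σ.arr 0 u v = 1) ∧ (¬ J.G.Adj u v → σ.arr 0 u v = 0)) ∧
  (∀ i : Fin J.k, σ.arr 1 i 0 = J.s i ∧ σ.arr 1 i 1 = J.t i)

/-!
An internal vertex of one of the paths lies on no other path, so it is not a terminal. In a split
graph the paths can be shortened: an occurrence of an adjacent pair uses the edge, or a single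
common neighbor of its terminals, and an occurrence of a nonadjacent pair needs only a nonterminal
neighbor `v` of its first terminal and a nonterminal neighbor `w` of its second one, where `v = w`
is allowed. Indeed, `v` and `w` belong to the clique if both terminals are independent vertices, and
otherwise one of `v`, `w` is adjacent to both terminals. So a solution is the same as a *routing*,
an assignment of nonterminal vertices to the `2 * k` *slots* (occurrences of terminals) such that
different pairs get different vertices (`VDPInstance.isYes_iff_exists_isRouting`).

The kernel keeps the terminals and the vertices matched by a matching of slots and serving
vertices, which makes at most `2 * k + 2 * k` vertices. The matching comes from an auction: a slot
takes a cheapest serving vertex, whose price goes up by one, from its present owner, and gives up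
when all its serving vertices have reached the price `2 * k + 1`. At most `2 * k` vertices have a
positive price, so some price between `1` and `2 * k + 1` is not attained. The set `Z` of the
vertices below such a price is a crown: each slot with a serving vertex in `Z` owns a vertex of `Z`
(`Auction.exists_threshold`), and all vertices outside `Z` are owned, hence kept. In any routing the
slots with a serving vertex in `Z` can move to the vertices that they own, while the other slots do
not use `Z` anyway. So the restriction to the kept vertices is an equivalent instance
(`VDPInstance.isYes_restrict_iff`).

If the graph is connected, then every kept vertex has a kept neighbor
(`VDPInstance.exists_kept_adj`), and a split graph without isolated vertices is connected.

The program is verified with `RAM.Reaches`, a weakest precondition with a time bound. The auction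
is fast because the sum of the prices is at most `n * (2 * k + 1)` and every bid increases this sum
or retires a slot (`VDPInstance.bidsLeft`).
-/

/-! ### Routings in split graphs -/

/-- A split graph without isolated vertices is connected. -/
theorem IsSplitGraph.preconnected {V : Type*} {G : SimpleGraph V} (hG : IsSplitGraph G)
    (h : ∀ x, ∃ y, G.Adj x y) : G.Preconnected := by
  obtain ⟨C, hC, hI⟩ := hG
  have toClique : ∀ x, ∃ c ∈ C, G.Reachable x c := by
    intro x
    by_cases hx : x ∈ C
    · exact ⟨x, hx, .refl x⟩
    · obtain ⟨y, hy⟩ := h x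
      refine ⟨y, ?_, hy.reachable⟩
      by_contra hyC
      exact hI hx hyC hy.ne hy
  intro x y
  obtain ⟨c, hc, hxc⟩ := toClique x
  obtain ⟨d, hd, hyd⟩ := toClique y
  refine hxc.trans (.trans ?_ hyd.symm)
  by_cases hcd : c = d
  · exact hcd ▸ .refl c
  · exact (hC hc hd hcd).reachable

theorem IsSplitGraph.comap {V W : Type*} {G : SimpleGraph V} (hG : IsSplitGraph G) {f : W → V}
    (hf : Function.Injective f) : IsSplitGraph (G.comap f) := by
  obtain ⟨C, hC, hI⟩ := hG
  refine ⟨f ⁻¹' C, fun x hx y hy hxy => hC hx hy (hf.ne hxy), fun x hx y hy hxy => ?_⟩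
  exact hI hx hy (hf.ne hxy)

/-- In a split graph, a path with internal vertices between two adjacent vertices can be
shortcut to a path with one internal vertex. -/
theorem IsSplitGraph.exists_common_neighbor {V : Type*} {G : SimpleGraph V} (hG : IsSplitGraph G)
    {s t : V} {p : G.Walk s t} (hp : p.IsPath) (hlen : 2 ≤ p.length) (hst : G.Adj s t) :
    ∃ v ∈ p.support, v ≠ s ∧ v ≠ t ∧ G.Adj s v ∧ G.Adj t v := by
  obtain ⟨C, hC, hI⟩ := hG
  have inj : ∀ i j, i ≤ p.length → j ≤ p.length → p.getVert i = p.getVert j → i = j :=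
    fun i j hi hj h => hp.getVert_injOn hi hj h
  have ne0 : ∀ i, 0 < i → i ≤ p.length → p.getVert i ≠ s := fun i h0 hi h => by
    have := inj i 0 hi (by omega) (by simpa using h)
    omega
  have neL : ∀ i, i < p.length → p.getVert i ≠ t := fun i hi h => by
    have := inj i p.length hi.le le_rfl (by simpa using h)
    omega
  have adj : ∀ i, i < p.length → G.Adj (p.getVert i) (p.getVert (i + 1)) :=
    fun i hi => p.adj_getVert_succ hi
  have a0 : G.Adj s (p.getVert 1) := by simpa using adj 0 (by omega)
  have aL : G.Adj t (p.getVert (p.length - 1)) := by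
    have h := adj (p.length - 1) (by omega)
    rw [Nat.sub_add_cancel (by omega), p.getVert_length] at h
    exact h.symm
  have ind : ∀ {x y}, G.Adj x y → x ∉ C → y ∈ C := fun h hx => by
    by_contra hy
    exact hI hx hy h.ne h
  have n1s := ne0 1 (by omega) (by omega)
  have n1t := neL 1 (by omega)
  have nLs := ne0 (p.length - 1) (by omega) (by omega)
  have nLt := neL (p.length - 1) (by omega)
  by_cases hs : s ∈ C
  · by_cases ht : t ∈ C
    · by_cases h1 : p.getVert 1 ∈ C
      · exact ⟨_, p.getVert_mem_support 1, n1s, n1t, a0, hC ht h1 n1t.symm⟩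
      · have h2 := ind (adj 1 (by omega)) h1
        by_cases hl : p.length = 2
        · rw [hl] at aL
          exact ⟨_, p.getVert_mem_support 1, n1s, n1t, a0, aL⟩
        · have n2s := ne0 2 (by omega) (by omega)
          have n2t := neL 2 (by omega)
          exact ⟨_, p.getVert_mem_support 2, n2s, n2t, hC hs h2 n2s.symm, hC ht h2 n2t.symm⟩
    · exact ⟨_, p.getVert_mem_support _, nLs, nLt, hC hs (ind aL ht) nLs.symm, aL⟩
  · exact ⟨_, p.getVert_mem_support 1, n1s, n1t, a0,
      hC (ind hst hs) (ind a0 hs) n1t.symm⟩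

namespace VDPInstance

/-- The terminals, indexed by *slots*: the slot `(i, false)` stands for the occurrence `s i`
and the slot `(i, true)` for the occurrence `t i`. -/
def terminal (I : VDPInstance) (c : Fin I.k × Bool) : Fin I.n :=
  if c.2 then I.t c.1 else I.s c.1

/-- The vertex occurs in a terminal pair. -/
def IsTerminal (I : VDPInstance) (v : Fin I.n) : Prop := ∃ c, I.terminal c = v

/-- The vertex `v` can be the internal vertex next to the terminal of the slot `c`. If the two
terminals of the pair are adjacent, then `v` is also required to be a neighbor of the other
one. -/
def Serves (I : VDPInstance) (c : Fin I.k × Bool) (v : Fin I.n) : Prop :=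
  ¬ I.IsTerminal v ∧ I.G.Adj (I.terminal c) v ∧
    (I.G.Adj (I.s c.1) (I.t c.1) → I.G.Adj (I.terminal (c.1, !c.2)) v)

/-- `a` assigns serving vertices to the slots of the pairs outside `B`, where different pairs get
different vertices (the two slots of one pair may share a vertex), and the pairs in `B` are
joined by different edges. -/
def IsRouting (I : VDPInstance) (B : Set (Fin I.k)) (a : Fin I.k × Bool → Fin I.n) : Prop :=
  (∀ i ∈ B, I.G.Adj (I.s i) (I.t i)) ∧
  (∀ i ∈ B, ∀ j ∈ B, i ≠ j → s(I.s i, I.t i) ≠ s(I.s j, I.t j)) ∧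
  (∀ c : Fin I.k × Bool, c.1 ∉ B → I.Serves c (a c)) ∧
  (∀ c d : Fin I.k × Bool, c.1 ∉ B → d.1 ∉ B → c.1 ≠ d.1 → a c ≠ a d)

theorem isTerminal_s (I : VDPInstance) (i : Fin I.k) : I.IsTerminal (I.s i) := ⟨(i, false), rfl⟩

theorem isTerminal_t (I : VDPInstance) (i : Fin I.k) : I.IsTerminal (I.t i) := ⟨(i, true), rfl⟩

theorem IsYes.exists_isRouting {I : VDPInstance} (hG : IsSplitGraph I.G) (h : I.IsYes) :
    ∃ B a, I.IsRouting B a := by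
  classical
  obtain ⟨P, hP⟩ := h
  have internal : ∀ i, ∀ v ∈ (P i).1.support, v ≠ I.s i → v ≠ I.t i → ¬ I.IsTerminal v := by
    rintro i v hv hs ht ⟨⟨j, b⟩, rfl⟩
    by_cases hij : i = j
    · subst hij
      cases b
      · exact hs rfl
      · exact ht rfl
    · refine (hP i j hij).2.1 _ hv hs ht ?_
      cases b
      · exact (P j).1.start_mem_support
      · exact (P j).1.end_mem_support
  have len : ∀ i, (P i).1.length ≠ 0 := fun i h0 =>
    I.s_ne_t i (SimpleGraph.Walk.eq_of_length_eq_zero h0)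
  -- For a nonadjacent pair, the neighbors of the terminals on the path serve the two slots; for an
  -- adjacent pair, a common neighbor serves both.
  have serve : ∀ c : Fin I.k × Bool, ∃ v, (P c.1).1.length ≠ 1 →
      v ∈ (P c.1).1.support ∧ v ≠ I.s c.1 ∧ v ≠ I.t c.1 ∧ I.Serves c v := by
    rintro ⟨i, b⟩
    by_cases h1 : (P i).1.length = 1
    · exact ⟨I.s i, fun h => absurd h1 h⟩
    have h2 : 2 ≤ (P i).1.length := by have := len i; omega
    by_cases hst : I.G.Adj (I.s i) (I.t i)
    · obtain ⟨v, hv, hs, ht, has, hat⟩ := hG.exists_common_neighbor (P i).2 h2 hst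
      refine ⟨v, fun _ => ⟨hv, hs, ht, internal i v hv hs ht, ?_⟩⟩
      cases b
      · exact ⟨has, fun _ => hat⟩
      · exact ⟨hat, fun _ => has⟩
    · have inj : ∀ m j, m ≤ (P i).1.length → j ≤ (P i).1.length →
          (P i).1.getVert m = (P i).1.getVert j → m = j :=
        fun m j hm hj h => (P i).2.getVert_injOn hm hj h
      have ne0 : ∀ m, 0 < m → m ≤ (P i).1.length → (P i).1.getVert m ≠ I.s i := fun m h0 hm h => by
        have := inj m 0 hm (by omega) (by simpa using h)
        omega
      have neL : ∀ m, m < (P i).1.length → (P i).1.getVert m ≠ I.t i := fun m hm h => by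
        have := inj m _ hm.le le_rfl (by simpa using h)
        omega
      cases b
      · have hs := ne0 1 (by omega) (by omega)
        have ht := neL 1 (by omega)
        have hv := (P i).1.getVert_mem_support 1
        refine ⟨_, fun _ => ⟨hv, hs, ht, internal i _ hv hs ht, ?_, fun h => absurd h hst⟩⟩
        have := (P i).1.adj_getVert_succ (i := 0) (by omega)
        simpa [terminal] using this
      · have hs := ne0 ((P i).1.length - 1) (by omega) (by omega)
        have ht := neL ((P i).1.length - 1) (by omega)
        have hv := (P i).1.getVert_mem_support ((P i).1.length - 1)
        refine ⟨_, fun _ => ⟨hv, hs, ht, internal i _ hv hs ht, ?_, fun h => absurd h hst⟩⟩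
        have := (P i).1.adj_getVert_succ (i := (P i).1.length - 1) (by omega)
        rw [Nat.sub_add_cancel (by omega), SimpleGraph.Walk.getVert_length] at this
        simpa [terminal] using this.symm
  choose a ha using serve
  -- The paths without internal vertices are edges, and distinct paths are distinct edges.
  refine ⟨{i | (P i).1.length = 1}, a, fun i hi => SimpleGraph.Walk.adj_of_length_eq_one hi, ?_,
    fun c hc => (ha c hc).2.2.2, ?_⟩
  · intro i hi j hj hij he
    have edge : ∀ {x y} (p : I.G.Walk x y), p.length = 1 →
        ∃ h : I.G.Adj x y, p = h.toWalk
      | _, _, .cons h .nil, _ => ⟨h, rfl⟩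
    obtain ⟨h, hi⟩ := edge _ hi
    obtain ⟨h', hj⟩ := edge _ hj
    apply (hP i j hij).1
    rw [hi, hj]
    have hV : ∀ v, (v = I.s i ∨ v = I.t i) ↔ (v = I.s j ∨ v = I.t j) := fun v => by
      rw [← Sym2.mem_iff, he, Sym2.mem_iff]
    apply SimpleGraph.Subgraph.ext
    · ext v
      simpa [SimpleGraph.Adj.toWalk] using hV v
    · ext v w
      rw [← SimpleGraph.Subgraph.mem_edgeSet, ← SimpleGraph.Subgraph.mem_edgeSet,
        SimpleGraph.Walk.mem_edges_toSubgraph, SimpleGraph.Walk.mem_edges_toSubgraph]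
      simp only [SimpleGraph.Adj.toWalk, SimpleGraph.Walk.edges_cons, SimpleGraph.Walk.edges_nil,
        List.mem_singleton]
      rw [he]
  · intro c d hc hd hcd he
    obtain ⟨hv, hs, ht, -⟩ := ha c hc
    exact (hP _ _ hcd).2.1 _ hv hs ht (he ▸ (ha d hd).1)

/-- If both slots of a pair are served, then the serving vertices are enough for a path. -/
theorem exists_path_of_serves {I : VDPInstance} (hG : IsSplitGraph I.G) {i : Fin I.k}
    {v w : Fin I.n} (hv : I.Serves (i, false) v) (hw : I.Serves (i, true) w) :
    ∃ p : I.G.Path (I.s i) (I.t i), (∃ x ∈ p.1.support, x = v ∨ x = w) ∧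
      ∀ x ∈ p.1.support, x = I.s i ∨ x = I.t i ∨ x = v ∨ x = w := by
  obtain ⟨hvT, hsv, hv'⟩ := hv
  obtain ⟨hwT, htw, hw'⟩ := hw
  simp only [terminal, Bool.not_false, Bool.not_true, if_true, Bool.false_eq_true, if_false] at *
  have hst := I.s_ne_t i
  have via : ∀ x, I.G.Adj (I.s i) x → I.G.Adj (I.t i) x → x = v ∨ x = w →
      ∃ p : I.G.Path (I.s i) (I.t i), (∃ x ∈ p.1.support, x = v ∨ x = w) ∧
      ∀ x ∈ p.1.support, x = I.s i ∨ x = I.t i ∨ x = v ∨ x = w := by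
    intro x hs ht hx
    refine ⟨⟨.cons hs (.cons ht.symm .nil), ?_⟩, ⟨x, by simp, hx⟩, ?_⟩
    · simp [hs.ne, ht.ne', hst]
    · simp only [SimpleGraph.Walk.support_cons, SimpleGraph.Walk.support_nil, List.mem_cons,
        List.not_mem_nil, or_false]
      rintro y (rfl | rfl | rfl) <;> tauto
  by_cases hadj : I.G.Adj (I.s i) (I.t i)
  · exact via v hsv (hv' hadj) (Or.inl rfl)
  obtain ⟨C, hC, hI⟩ := hG
  have ind : ∀ {x y}, I.G.Adj x y → x ∉ C → y ∈ C := fun h hx => by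
    by_contra hy
    exact hI hx hy h.ne h
  -- If one terminal is in the clique, then the neighbor of the other one is adjacent to both.
  have hvt : v ≠ I.t i := fun h => hvT (h ▸ I.isTerminal_t i)
  have hws : w ≠ I.s i := fun h => hwT (h ▸ I.isTerminal_s i)
  by_cases hs : I.s i ∈ C
  · have ht : I.t i ∉ C := fun ht => hadj (hC hs ht hst)
    exact via w (hC hs (ind htw ht) hws.symm) htw (Or.inr rfl)
  · by_cases ht : I.t i ∈ C
    · exact via v hsv (hC ht (ind hsv hs) hvt.symm) (Or.inl rfl)
    · by_cases hvw : v = w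
      · exact via v hsv (hvw ▸ htw) (Or.inl rfl)
      · refine ⟨⟨.cons hsv (.cons (hC (ind hsv hs) (ind htw ht) hvw) (.cons htw.symm .nil)), ?_⟩,
          ⟨v, by simp, Or.inl rfl⟩, ?_⟩
        · simp [hsv.ne, htw.ne', hst, hvw, hvt, hws.symm]
        · simp only [SimpleGraph.Walk.support_cons, SimpleGraph.Walk.support_nil, List.mem_cons,
            List.not_mem_nil, or_false]
          tauto

theorem IsRouting.isYes {I : VDPInstance} (hG : IsSplitGraph I.G) {B : Set (Fin I.k)}
    {a : Fin I.k × Bool → Fin I.n} (h : I.IsRouting B a) : I.IsYes := by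
  classical
  obtain ⟨hB, hBB, ha, haa⟩ := h
  have key : ∀ i, ∃ p : I.G.Path (I.s i) (I.t i),
      (i ∈ B → p.1.edges = [s(I.s i, I.t i)] ∧ ∀ x ∈ p.1.support, x = I.s i ∨ x = I.t i) ∧
      (i ∉ B → (∃ x ∈ p.1.support, ∃ b, x = a (i, b)) ∧
        ∀ x ∈ p.1.support, x = I.s i ∨ x = I.t i ∨ ∃ b, x = a (i, b)) := by
    intro i
    by_cases hi : i ∈ B
    · refine ⟨.singleton (hB i hi), fun _ => ⟨?_, ?_⟩, fun h => absurd hi h⟩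
      · simp [SimpleGraph.Path.singleton]
      · simp [SimpleGraph.Path.singleton]
    · obtain ⟨p, hp, hp'⟩ := exists_path_of_serves hG (ha (i, false) hi) (ha (i, true) hi)
      refine ⟨p, fun h => absurd h hi, fun _ => ⟨?_, fun x hx => ?_⟩⟩
      · obtain ⟨x, hx, rfl | rfl⟩ := hp
        · exact ⟨_, hx, false, rfl⟩
        · exact ⟨_, hx, true, rfl⟩
      · rcases hp' x hx with h | h | h | h
        · exact Or.inl h
        · exact Or.inr (Or.inl h)
        · exact Or.inr (Or.inr ⟨_, h⟩)
        · exact Or.inr (Or.inr ⟨_, h⟩)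
  choose P hPB hPa using key
  have notMem : ∀ i j, i ≠ j → i ∉ B → ∀ b, a (i, b) ∉ (P j).1.support := by
    intro i j hij hi b hm
    have hT := (ha (i, b) hi).1
    by_cases hj : j ∈ B
    · rcases (hPB j hj).2 _ hm with h | h
      · exact hT (h ▸ I.isTerminal_s j)
      · exact hT (h ▸ I.isTerminal_t j)
    · rcases (hPa j hj).2 _ hm with h | h | ⟨b', h⟩
      · exact hT (h ▸ I.isTerminal_s j)
      · exact hT (h ▸ I.isTerminal_t j)
      · exact haa (i, b) (j, b') hi hj hij h
  have disj : ∀ i j, i ≠ j → ∀ v ∈ (P i).1.support, v ≠ I.s i → v ≠ I.t i →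
      v ∉ (P j).1.support := by
    intro i j hij v hv hs ht
    by_cases hi : i ∈ B
    · exact ((hPB i hi).2 v hv).elim (fun h => absurd h hs) (fun h => absurd h ht)
    · rcases (hPa i hi).2 v hv with h | h | ⟨b, rfl⟩
      · exact absurd h hs
      · exact absurd h ht
      · exact notMem i j hij hi b
  -- A path with an internal vertex differs from all others, because this vertex is its own.
  have ne : ∀ i j, i ≠ j → i ∉ B → (P i).1.toSubgraph ≠ (P j).1.toSubgraph := by
    intro i j hij hi he
    obtain ⟨x, hx, b, rfl⟩ := (hPa i hi).1
    refine notMem i j hij hi b ?_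
    rw [← SimpleGraph.Walk.mem_verts_toSubgraph, ← he, SimpleGraph.Walk.mem_verts_toSubgraph]
    exact hx
  refine ⟨P, fun i j hij => ⟨?_, disj i j hij, disj j i hij.symm⟩⟩
  by_cases hi : i ∈ B
  · by_cases hj : j ∈ B
    · intro he
      have : s(I.s i, I.t i) ∈ (P i).1.toSubgraph.edgeSet := by
        rw [SimpleGraph.Walk.mem_edges_toSubgraph, (hPB i hi).1]
        simp
      rw [he, SimpleGraph.Walk.mem_edges_toSubgraph, (hPB j hj).1] at this
      exact hBB i hi j hj hij (by simpa using this)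
    · exact (ne j i hij.symm hj).symm
  · exact ne i j hij hi

theorem isYes_iff_exists_isRouting {I : VDPInstance} (hG : IsSplitGraph I.G) :
    I.IsYes ↔ ∃ B a, I.IsRouting B a :=
  ⟨fun h => h.exists_isRouting hG, fun ⟨_, _, h⟩ => h.isYes hG⟩

/-! ### Restriction to a set of vertices -/

/-- The instance induced on the vertices in the range of `o`, which contains all terminals. -/
def restrict (I : VDPInstance) {m : ℕ} (o : Fin m → Fin I.n) (s t : Fin I.k → Fin m)
    (hs : ∀ i, o (s i) = I.s i) (ht : ∀ i, o (t i) = I.t i) : VDPInstance where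
  n := m
  G := I.G.comap o
  k := I.k
  s := s
  t := t
  s_ne_t i h := I.s_ne_t i (by rw [← hs, ← ht, h])

/-- The set `K` contains enough nonterminal vertices for all routings: the serving vertices
outside some set `Z` belong to `K`, and the slots that are served by a vertex in `Z` have
different serving vertices in `Z ∩ K`. -/
def Suffices (I : VDPInstance) (K : Set (Fin I.n)) : Prop :=
  ∃ (Z : Set (Fin I.n)) (m : Fin I.k × Bool → Fin I.n),
    (∀ c v, I.Serves c v → v ∉ Z → v ∈ K) ∧
    (∀ c, ∀ v ∈ Z, I.Serves c v → I.Serves c (m c) ∧ m c ∈ Z ∧ m c ∈ K) ∧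
    (∀ c d, ∀ v ∈ Z, ∀ w ∈ Z, I.Serves c v → I.Serves d w → m c = m d → c = d)

/-- A routing can be changed so that it uses vertices in a sufficient set only: the slots that
are served by a vertex in `Z` move to their private vertices, and the others do not use `Z`. -/
theorem IsRouting.exists_mem {I : VDPInstance} {K : Set (Fin I.n)} (hK : I.Suffices K)
    {B : Set (Fin I.k)} {a : Fin I.k × Bool → Fin I.n} (h : I.IsRouting B a) :
    ∃ a', I.IsRouting B a' ∧ ∀ c : Fin I.k × Bool, c.1 ∉ B → a' c ∈ K := by
  classical
  obtain ⟨Z, m, hZ, hm, hinj⟩ := hK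
  obtain ⟨hB, hBB, ha, haa⟩ := h
  refine ⟨fun c => if ∃ v ∈ Z, I.Serves c v then m c else a c, ⟨hB, hBB, ?_, ?_⟩, ?_⟩
  · intro c hc
    dsimp only
    split_ifs with h
    · obtain ⟨v, hv, hcv⟩ := h
      exact (hm c v hv hcv).1
    · exact ha c hc
  · intro c d hc hd hcd
    dsimp only
    have outside : ∀ c : Fin I.k × Bool, c.1 ∉ B → (¬ ∃ v ∈ Z, I.Serves c v) → a c ∉ Z :=
      fun c hc h hac => h ⟨_, hac, ha c hc⟩
    split_ifs with h h' h'
    · obtain ⟨v, hv, hcv⟩ := h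
      obtain ⟨w, hw, hdw⟩ := h'
      exact fun he => hcd (congrArg Prod.fst (hinj c d v hv w hw hcv hdw he))
    · obtain ⟨v, hv, hcv⟩ := h
      exact fun he => outside d hd h' (he ▸ (hm c v hv hcv).2.1)
    · obtain ⟨v, hv, hcv⟩ := h'
      exact fun he => outside c hc h (he ▸ (hm d v hv hcv).2.1)
    · exact haa c d hc hd hcd
  · intro c hc
    dsimp only
    split_ifs with h
    · obtain ⟨v, hv, hcv⟩ := h
      exact (hm c v hv hcv).2.2
    · exact hZ c _ (ha c hc) fun hac => h ⟨_, hac, ha c hc⟩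

theorem isYes_restrict_iff {I : VDPInstance} (hG : IsSplitGraph I.G) {m : ℕ}
    {o : Fin m → Fin I.n} (ho : Function.Injective o) {s t : Fin I.k → Fin m}
    (hs : ∀ i, o (s i) = I.s i) (ht : ∀ i, o (t i) = I.t i) (hK : I.Suffices (Set.range o)) :
    I.IsYes ↔ (I.restrict o s t hs ht).IsYes := by
  set J := I.restrict o s t hs ht with hJ
  have term : ∀ c : Fin I.k × Bool, o (J.terminal c) = I.terminal c := by
    rintro ⟨i, _ | _⟩
    · exact hs i
    · exact ht i
  have isTerm : ∀ v : Fin m, J.IsTerminal v ↔ I.IsTerminal (o v) := fun v =>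
    exists_congr fun c => by rw [← term c]; exact ho.eq_iff.symm
  have adj : ∀ i : Fin I.k, J.G.Adj (J.s i) (J.t i) ↔ I.G.Adj (I.s i) (I.t i) := fun i => by
    rw [← hs, ← ht]
    rfl
  have serves : ∀ (c : Fin I.k × Bool) (v : Fin m),
      J.Serves c v ↔ I.Serves c (o v) := fun c v => by
    unfold Serves
    rw [isTerm, ← term c, ← term (c.1, !c.2), adj]
    rfl
  have pair : ∀ i j : Fin I.k, s(J.s i, J.t i) = s(J.s j, J.t j) ↔
      s(I.s i, I.t i) = s(I.s j, I.t j) := fun i j => by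
    rw [← hs, ← ht, ← hs, ← ht]
    exact ((Sym2.map.injective ho).eq_iff (a := s(s i, t i)) (b := s(s j, t j))).symm
  rw [isYes_iff_exists_isRouting hG, isYes_iff_exists_isRouting (I := J) (hG.comap ho)]
  constructor
  · rintro ⟨B, a, h⟩
    obtain ⟨a', ⟨hB, hBB, ha, haa⟩, hrange⟩ := h.exists_mem hK
    have : ∀ c : Fin I.k × Bool, ∃ v : Fin m, c.1 ∉ B → o v = a' c := fun c => by
      by_cases hc : c.1 ∈ B
      · exact ⟨s c.1, fun h => absurd hc h⟩
      · obtain ⟨v, hv⟩ := hrange c hc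
        exact ⟨v, fun _ => hv⟩
    choose a'' ha'' using this
    refine ⟨B, a'', fun i hi => (adj i).2 (hB i hi), ?_, ?_, ?_⟩
    · exact fun i hi j hj hij he => hBB i hi j hj hij ((pair i j).1 he)
    · intro c hc
      refine (serves c _).2 ?_
      rw [ha'' c hc]
      exact ha c hc
    · intro c d hc hd hcd he
      apply haa c d hc hd hcd
      rw [← ha'' c hc, ← ha'' d hd, he]
  · rintro ⟨B, a, hB, hBB, ha, haa⟩
    refine ⟨B, fun c => o (a c), fun i hi => (adj i).1 (hB i hi), ?_, ?_, ?_⟩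
    · exact fun i hi j hj hij he => hBB i hi j hj hij ((pair i j).2 he)
    · exact fun c hc => (serves c _).1 (ha c hc)
    · exact fun c d hc hd hcd he => haa c d hc hd hcd (ho he)

end VDPInstance

/-! ### An auction for a matching of slots and vertices -/

/-- The state of an auction in which the bidders `1, 2, …` bid for the items `0, …, n - 1`, and
where `N c w` says that bidder `c` is interested in item `w`. The bidders up to `q` have entered
the auction; `owner w` is the present owner of `w`, where `0` means that there is none, and
`price w` counts how often `w` has been sold; `hand` is the bidder who bids next, if it is not
`0`. A bidder takes a cheapest item of interest from its owner, or retires if the price of all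
items of interest has reached `L`. -/
structure Auction (n L : ℕ) (N : ℕ → ℕ → Prop) (q hand : ℕ) (price owner : ℕ → ℕ) : Prop where
  price_le : ∀ w < n, price w ≤ L
  price_eq_zero_iff : ∀ w < n, (price w = 0 ↔ owner w = 0)
  owner_le : ∀ w < n, owner w ≤ q
  owner_inj : ∀ w < n, ∀ w' < n, owner w = owner w' → owner w ≠ 0 → w = w'
  hand_le : hand ≤ q
  hand_free : ∀ w < n, owner w = hand → hand = 0
  interest : ∀ w < n, owner w ≠ 0 → N (owner w) w
  price_le_add_one : ∀ w < n, owner w ≠ 0 → ∀ w' < n, N (owner w) w' → price w ≤ price w' + 1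
  settled : ∀ c, 0 < c → c ≤ q → c ≠ hand →
    (∃ w < n, owner w = c) ∨ ∀ w < n, N c w → L ≤ price w

namespace Auction

variable {n L : ℕ} {N : ℕ → ℕ → Prop} {q hand : ℕ} {price owner : ℕ → ℕ}

/-- The auction before the first bidder enters. -/
theorem init (hp : ∀ w < n, price w = 0) (ho : ∀ w < n, owner w = 0) :
    Auction n L N 0 0 price owner where
  price_le w hw := by simp [hp w hw]
  price_eq_zero_iff w hw := by simp [hp w hw, ho w hw]
  owner_le w hw := by simp [ho w hw]
  owner_inj w hw _ _ _ h := absurd (ho w hw) h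
  hand_le := le_rfl
  hand_free _ _ _ := rfl
  interest w hw h := absurd (ho w hw) h
  price_le_add_one w hw h := absurd (ho w hw) h
  settled c h h' := by omega

/-- If no bidder is waiting to bid, then the next one may enter. -/
theorem enter (h : Auction n L N q 0 price owner) :
    Auction n L N (q + 1) (q + 1) price owner where
  price_le := h.price_le
  price_eq_zero_iff := h.price_eq_zero_iff
  owner_le w hw := (h.owner_le w hw).trans q.le_succ
  owner_inj := h.owner_inj
  hand_le := le_rfl
  hand_free w hw he := by have := h.owner_le w hw; omega
  interest := h.interest
  price_le_add_one := h.price_le_add_one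
  settled c hc hcq hne := h.settled c hc (by omega) (by omega)

/-- A bidder all of whose items of interest are too expensive leaves the auction. -/
theorem retire (h : Auction n L N q hand price owner) (hL : ∀ w < n, N hand w → L ≤ price w) :
    Auction n L N q 0 price owner where
  price_le := h.price_le
  price_eq_zero_iff := h.price_eq_zero_iff
  owner_le := h.owner_le
  owner_inj := h.owner_inj
  hand_le := q.zero_le
  hand_free _ _ _ := rfl
  interest := h.interest
  price_le_add_one := h.price_le_add_one
  settled c hc hcq _ := by
    by_cases hch : c = hand
    · exact Or.inr (hch ▸ hL)
    · exact h.settled c hc hcq hch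

/-- A bidder takes a cheapest item of interest, and its previous owner bids next. -/
theorem bid (h : Auction n L N q hand price owner) (h0 : hand ≠ 0) {b : ℕ} (hb : b < n)
    (hN : N hand b) (hL : price b < L) (hmin : ∀ w < n, N hand w → price b ≤ price w)
    {price' owner' : ℕ → ℕ} (hp : ∀ w, price' w = if w = b then price b + 1 else price w)
    (ho : ∀ w, owner' w = if w = b then hand else owner w) :
    Auction n L N q (owner b) price' owner' := by
  have mono : ∀ w, price w ≤ price' w := fun w => by
    rw [hp]
    split_ifs with hw
    · subst hw; omega
    · exact le_rfl
  have free := h.hand_free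
  constructor
  · intro w hw
    rw [hp]
    split_ifs
    · omega
    · exact h.price_le w hw
  · intro w hw
    rw [hp, ho]
    split_ifs
    · simp [h0]
    · exact h.price_eq_zero_iff w hw
  · intro w hw
    rw [ho]
    split_ifs
    · exact h.hand_le
    · exact h.owner_le w hw
  · intro w hw w' hw'
    rw [ho, ho]
    split_ifs with h1 h2 h2
    · intros; omega
    · intro he; exact absurd (free w' hw' he.symm) h0
    · intro he; exact absurd (free w hw he) h0
    · exact h.owner_inj w hw w' hw'
  · exact h.owner_le b hb
  · intro w hw
    rw [ho]
    split_ifs with h1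
    · intro he; exact absurd (free b hb he.symm) h0
    · intro he
      by_contra hne
      exact h1 (h.owner_inj w hw b hb he (he ▸ hne))
  · intro w hw
    rw [ho]
    split_ifs with h1
    · exact fun _ => h1 ▸ hN
    · exact h.interest w hw
  · intro w hw
    rw [ho]
    split_ifs with h1
    · intro _ w' hw' hN'
      rw [hp w, if_pos h1]
      have := hmin w' hw' hN'
      have := mono w'
      omega
    · intro hne w' hw' hN'
      rw [hp w, if_neg h1]
      have := h.price_le_add_one w hw hne w' hw' hN'
      have := mono w'
      omega
  · intro c hc hcq hcb
    by_cases hch : c = hand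
    · exact Or.inl ⟨b, hb, by rw [ho, if_pos rfl, hch]⟩
    · rcases h.settled c hc hcq hch with ⟨w, hw, rfl⟩ | hc
      · refine Or.inl ⟨w, hw, ?_⟩
        rw [ho, if_neg (by rintro rfl; exact hcb rfl)]
      · exact Or.inr fun w hw hcw => (hc w hw hcw).trans (mono w)

theorem sum_price_le (h : Auction n L N q hand price owner) :
    ∑ w ∈ Finset.range n, price w ≤ n * L := by
  simpa using Finset.sum_le_card_nsmul (Finset.range n) price L
    fun w hw => h.price_le w (Finset.mem_range.1 hw)

/-- If the bound on the prices exceeds the number `q` of bidders, then some price `l` between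
`1` and `q + 1` is not attained, since only owned items have positive prices. A bidder who is
interested in some item cheaper than `l` owns an item of price at most `l`, hence cheaper
than `l`. -/
theorem exists_threshold (h : Auction n (q + 1) N q 0 price owner) :
    ∃ l, 0 < l ∧ ∀ c, 0 < c → c ≤ q → ∀ w < n, N c w → price w < l →
      ∃ w' < n, owner w' = c ∧ price w' < l := by
  obtain ⟨l, hl0, hlq, hl⟩ : ∃ l, 0 < l ∧ l ≤ q + 1 ∧ ∀ w < n, price w ≠ l := by
    by_contra! hcon
    have : ∀ l, ∃ w, 0 < l → l ≤ q + 1 → w < n ∧ price w = l := fun l => by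
      by_cases hl : 0 < l ∧ l ≤ q + 1
      · obtain ⟨w, hw⟩ := hcon l hl.1 hl.2
        exact ⟨w, fun _ _ => hw⟩
      · exact ⟨0, fun h1 h2 => absurd ⟨h1, h2⟩ hl⟩
    choose f hf using this
    have pos : ∀ l, 0 < l → l ≤ q + 1 → owner (f l) ≠ 0 := fun l h0 h1 he => by
      obtain ⟨hw, hp⟩ := hf l h0 h1
      have := (h.price_eq_zero_iff _ hw).2 he
      omega
    obtain ⟨x, hx, y, hy, hxy, he⟩ := Finset.exists_ne_map_eq_of_card_lt_of_maps_to
      (s := Finset.Icc 1 (q + 1)) (t := Finset.Icc 1 q) (f := fun l => owner (f l)) (by simp)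
      (fun l hl => by
        simp only [Finset.coe_Icc, Set.mem_Icc] at hl ⊢
        have := h.owner_le _ (hf l (by omega) hl.2).1
        have := pos l (by omega) hl.2
        omega)
    rw [Finset.mem_Icc] at hx hy
    obtain ⟨hwx, hpx⟩ := hf x (by omega) hx.2
    obtain ⟨hwy, hpy⟩ := hf y (by omega) hy.2
    have := h.owner_inj _ hwx _ hwy he (pos x (by omega) hx.2)
    exact hxy (by rw [← hpx, ← hpy, this])
  refine ⟨l, hl0, fun c hc hcq w hw hN hwl => ?_⟩
  rcases h.settled c hc hcq (by omega) with ⟨w', hw', rfl⟩ | hL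
  · refine ⟨w', hw', rfl, ?_⟩
    have := h.price_le_add_one w' hw' (by omega) w hw hN
    have := hl w' hw'
    omega
  · have := hL w hw hN
    omega

end Auction

/-! ### The kept vertices -/

namespace VDPInstance

/-- The number of a slot, counting from `1`: first the slots of the terminals `s i`, then those
of the terminals `t i`. -/
def slotNumber (I : VDPInstance) (c : Fin I.k × Bool) : ℕ :=
  (if c.2 then I.k + c.1 else c.1) + 1

/-- The relation `Serves` in terms of the numbers of slots and vertices. -/
def ServesNumber (I : VDPInstance) (c w : ℕ) : Prop :=
  ∃ (x : Fin I.k × Bool) (v : Fin I.n), I.slotNumber x = c ∧ (v : ℕ) = w ∧ I.Serves x v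

theorem slotNumber_injective (I : VDPInstance) : Function.Injective I.slotNumber := by
  rintro ⟨i, b⟩ ⟨j, b'⟩ h
  have := i.2
  have := j.2
  simp only [slotNumber] at h
  cases b <;> cases b' <;> simp at h ⊢ <;> omega

theorem slotNumber_pos (I : VDPInstance) (c : Fin I.k × Bool) : 0 < I.slotNumber c :=
  Nat.succ_pos _

theorem slotNumber_le (I : VDPInstance) (c : Fin I.k × Bool) : I.slotNumber c ≤ I.k + I.k := by
  have := c.1.2
  simp only [slotNumber]
  split_ifs <;> omega

theorem exists_slotNumber_eq (I : VDPInstance) {c : ℕ} (hc : 0 < c) (hc' : c ≤ I.k + I.k) :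
    ∃ x, I.slotNumber x = c := by
  by_cases h : c ≤ I.k
  · exact ⟨(⟨c - 1, by omega⟩, false), by simp [slotNumber]; omega⟩
  · exact ⟨(⟨c - 1 - I.k, by omega⟩, true), by simp [slotNumber]; omega⟩

/-- The terminals, and the vertices that are owned by a slot at the end of the auction. -/
def kept (I : VDPInstance) (owner : ℕ → ℕ) : Set (Fin I.n) :=
  {v | I.IsTerminal v ∨ owner v ≠ 0}

variable {I : VDPInstance} {price owner : ℕ → ℕ}

theorem suffices_kept
    (h : Auction I.n (I.k + I.k + 1) I.ServesNumber (I.k + I.k) 0 price owner) :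
    I.Suffices (I.kept owner) := by
  obtain ⟨l, hl, hthr⟩ := h.exists_threshold
  have key : ∀ c : Fin I.k × Bool, ∃ m : Fin I.n, ∀ v : Fin I.n, price v < l → I.Serves c v →
      owner m = I.slotNumber c ∧ price m < l := by
    intro c
    by_cases hc : ∃ v : Fin I.n, price v < l ∧ I.Serves c v
    · obtain ⟨v, hv, hcv⟩ := hc
      obtain ⟨w, hw, h1, h2⟩ := hthr _ (I.slotNumber_pos c) (I.slotNumber_le c) v v.2
        ⟨c, v, rfl, rfl, hcv⟩ hv
      exact ⟨⟨w, hw⟩, fun _ _ _ => ⟨h1, h2⟩⟩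
    · exact ⟨I.s c.1, fun v hv hcv => absurd ⟨v, hv, hcv⟩ hc⟩
  choose m hm using key
  -- Vertices of price at least `l` have a positive price, so they are owned and kept.
  refine ⟨{v | price v < l}, m, ?_, ?_, ?_⟩
  · intro c v _ hv
    refine Or.inr fun h0 => hv ?_
    have := (h.price_eq_zero_iff v v.2).2 h0
    simp only [Set.mem_ofPred_eq]
    omega
  · intro c v hv hcv
    obtain ⟨h1, h2⟩ := hm c v hv hcv
    have h0 : owner (m c) ≠ 0 := h1 ▸ (I.slotNumber_pos c).ne'
    obtain ⟨x, w, hx, hw, hxw⟩ := h.interest _ (m c).2 h0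
    obtain rfl := I.slotNumber_injective (hx.trans h1)
    obtain rfl := Fin.ext hw
    exact ⟨hxw, h2, Or.inr h0⟩
  · intro c d v hv w hw hcv hdw he
    apply I.slotNumber_injective
    rw [← (hm c v hv hcv).1, ← (hm d w hw hdw).1, he]

/-- For a terminal of a nonadjacent pair with a nonterminal neighbor: its slot owns such a neighbor,
or all of them are expensive and hence owned by other slots. -/
theorem exists_kept_adj (h : Auction I.n (I.k + I.k + 1) I.ServesNumber (I.k + I.k) 0 price owner)
    (hG : I.G.Preconnected) {v : Fin I.n} (hv : v ∈ I.kept owner) :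
    ∃ w ∈ I.kept owner, I.G.Adj v w := by
  by_cases hvT : I.IsTerminal v
  -- The instance has two different terminals, so connectedness gives a terminal some neighbor.
  · obtain ⟨c, rfl⟩ := hvT
    by_cases hst : I.G.Adj (I.s c.1) (I.t c.1)
    · obtain ⟨i, _ | _⟩ := c
      · exact ⟨I.t i, Or.inl (I.isTerminal_t i), hst⟩
      · exact ⟨I.s i, Or.inl (I.isTerminal_s i), hst.symm⟩
    · have hne : I.terminal c ≠ I.terminal (c.1, !c.2) := by
        obtain ⟨i, _ | _⟩ := c
        · exact I.s_ne_t i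
        · exact (I.s_ne_t i).symm
      obtain ⟨p⟩ := hG (I.terminal c) (I.terminal (c.1, !c.2))
      have hx := p.adj_snd (SimpleGraph.Walk.not_nil_of_ne hne)
      by_cases hxT : I.IsTerminal p.snd
      · exact ⟨_, Or.inl hxT, hx⟩
      · rcases h.settled _ (I.slotNumber_pos c) (I.slotNumber_le c) (I.slotNumber_pos c).ne' with
          ⟨w, hw, ho⟩ | hL
        · have h0 : owner w ≠ 0 := ho ▸ (I.slotNumber_pos c).ne'
          obtain ⟨x, u, hx, rfl, hxu⟩ := h.interest w hw h0
          obtain rfl := I.slotNumber_injective (hx.trans ho)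
          exact ⟨u, Or.inr h0, hxu.2.1⟩
        · have := hL _ p.snd.2 ⟨c, _, rfl, rfl, hxT, hx, fun h => absurd h hst⟩
          refine ⟨_, Or.inr fun h0 => ?_, hx⟩
          have := (h.price_eq_zero_iff _ p.snd.2).2 h0
          omega
  · obtain ⟨x, u, -, hu, hxu⟩ := h.interest v v.2 (hv.resolve_left hvT)
    obtain rfl := Fin.ext hu
    exact ⟨_, Or.inl ⟨x, rfl⟩, hxu.2.1.symm⟩

theorem card_le_of_range_eq_kept
    (h : Auction I.n (I.k + I.k + 1) I.ServesNumber (I.k + I.k) 0 price owner) {m : ℕ}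
    {o : Fin m → Fin I.n} (ho : Function.Injective o) (hrange : Set.range o = I.kept owner) :
    m ≤ 4 * I.k := by
  classical
  have hT : (Finset.univ.filter I.IsTerminal).card ≤ 2 * I.k := by
    refine (Finset.card_le_card (t := Finset.univ.image I.terminal) fun v hv => ?_).trans
      (Finset.card_image_le.trans ?_)
    · obtain ⟨c, hc⟩ := (Finset.mem_filter.1 hv).2
      exact Finset.mem_image.2 ⟨c, Finset.mem_univ c, hc⟩
    · simp [mul_comm]
  have hO : (Finset.univ.filter fun v : Fin I.n => owner v ≠ 0).card ≤ 2 * I.k := by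
    rw [← Nat.add_sub_cancel (2 * I.k) 1, ← Nat.card_Icc]
    refine Finset.card_le_card_of_injOn (fun v => owner v) ?_ ?_
    · intro v hv
      have hv : owner v ≠ 0 := by simpa using hv
      have := h.owner_le v v.2
      simp only [Finset.coe_Icc, Set.mem_Icc]
      omega
    · intro v hv w _ he
      have hv : owner v ≠ 0 := by simpa using hv
      exact Fin.ext (h.owner_inj v v.2 w w.2 he hv)
  have : m = (Finset.univ.image o).card := by
    rw [Finset.card_image_of_injective _ ho, Finset.card_univ, Fintype.card_fin]
  rw [this]
  refine (Finset.card_le_card (t := Finset.univ.filter I.IsTerminal ∪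
    Finset.univ.filter fun v : Fin I.n => owner v ≠ 0) fun v hv => ?_).trans
    ((Finset.card_union_le _ _).trans (by omega))
  have : v ∈ I.kept owner := hrange ▸ by simpa using hv
  simpa [kept] using this

end VDPInstance

/-! ### Running time and correctness of programs -/

namespace RAM

@[simp] theorem State.reg_setReg (σ : State) (x v y : ℕ) :
    (σ.setReg x v).reg y = if y = x then v else σ.reg y := rfl

@[simp] theorem State.arr_setReg (σ : State) (x v : ℕ) : (σ.setReg x v).arr = σ.arr := rfl

@[simp] theorem State.reg_setArr (σ : State) (a i j v : ℕ) : (σ.setArr a i j v).reg = σ.reg := rfl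

theorem State.arr_setArr_self (σ : State) (a i j v i' j' : ℕ) :
    (σ.setArr a i j v).arr a i' j' = if i' = i ∧ j' = j then v else σ.arr a i' j' := by
  simp [State.setArr]

theorem State.arr_setArr_of_ne (σ : State) {a b : ℕ} (h : b ≠ a) (i j v : ℕ) :
    (σ.setArr a i j v).arr b = σ.arr b := by
  funext i' j'
  simp [State.setArr, h]

/-- Started in `σ`, the program `c` halts after at most `T` steps in a state with property `Q`. -/
def Reaches (c : Prog) (T : ℕ) (σ : State) (Q : State → Prop) : Prop :=
  ∃ τ t, Runs c σ τ t ∧ t ≤ T ∧ Q τ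

namespace Reaches

variable {c d : Prog} {S T : ℕ} {σ : State} {Q R : State → Prop}

theorem mono (h : Reaches c S σ Q) (hST : S ≤ T) (hQR : ∀ τ, Q τ → R τ) : Reaches c T σ R := by
  obtain ⟨τ, t, hr, ht, hq⟩ := h
  exact ⟨τ, t, hr, ht.trans hST, hQR τ hq⟩

theorem skip (h : Q σ) : Reaches .skip 1 σ Q := ⟨_, _, .skip σ, le_rfl, h⟩

theorem assign {x : ℕ} {e : Term} (h : Q (σ.setReg x (e.eval σ))) :
    Reaches (.assign x e) 1 σ Q := ⟨_, _, .assign σ x e, le_rfl, h⟩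

theorem write {a : ℕ} {i j e : Term} (h : Q (σ.setArr a (i.eval σ) (j.eval σ) (e.eval σ))) :
    Reaches (.write a i j e) 1 σ Q := ⟨_, _, .write σ a i j e, le_rfl, h⟩

theorem seq (h : Reaches c S σ fun τ => Reaches d T τ Q) : Reaches (.seq c d) (S + T) σ Q := by
  obtain ⟨τ, s, hs, hsS, υ, t, ht, htT, hq⟩ := h
  exact ⟨υ, s + t, .seq hs ht, Nat.add_le_add hsS htT, hq⟩

theorem assign_seq {x : ℕ} {e : Term} (h : Reaches d T (σ.setReg x (e.eval σ)) Q) :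
    Reaches (.seq (.assign x e) d) (T + 1) σ Q := by
  rw [add_comm]
  exact seq (assign h)

theorem write_seq {a : ℕ} {i j e : Term}
    (h : Reaches d T (σ.setArr a (i.eval σ) (j.eval σ) (e.eval σ)) Q) :
    Reaches (.seq (.write a i j e) d) (T + 1) σ Q := by
  rw [add_comm]
  exact seq (write h)

theorem ite {e : Term} (hc : e.eval σ ≠ 0 → Reaches c T σ Q) (hd : e.eval σ = 0 → Reaches d T σ Q) :
    Reaches (.ite e c d) (T + 1) σ Q := by
  by_cases he : e.eval σ = 0
  · obtain ⟨τ, t, hr, ht, hq⟩ := hd he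
    exact ⟨τ, t + 1, .ite_neg he hr, by omega, hq⟩
  · obtain ⟨τ, t, hr, ht, hq⟩ := hc he
    exact ⟨τ, t + 1, .ite_pos he hr, by omega, hq⟩

/-- The rule for loops: `Inv m` is an invariant which bounds the number of remaining rounds
by `m`. -/
theorem loop {e : Term} {Inv : ℕ → State → Prop}
    (hc : ∀ m σ, Inv m σ → e.eval σ ≠ 0 → Reaches c S σ fun τ => ∃ m' < m, Inv m' τ) (m : ℕ)
    (h : Inv m σ) :
    Reaches (.loop e c) (m * (S + 1) + 1) σ fun τ => (∃ m', Inv m' τ) ∧ e.eval τ = 0 := by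
  induction m using Nat.strong_induction_on generalizing σ with
  | _ m ih =>
    by_cases he : e.eval σ = 0
    · exact ⟨σ, 1, Runs.loop_stop he, by omega, ⟨m, h⟩, he⟩
    · obtain ⟨τ, s, hs, hsS, m', hm', hi⟩ := hc m σ h he
      obtain ⟨υ, t, ht, htT, hq⟩ := ih m' hm' hi
      refine ⟨υ, s + t + 1, .loop_step he hs ht, ?_, hq⟩
      have : (m' + 1) * (S + 1) ≤ m * (S + 1) := Nat.mul_le_mul_right _ hm'
      rw [add_mul] at this
      omega

end Reaches

/-- Repeat `c` while register `x` counts from `0` up to the value of `e`. -/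
def Prog.forLoop (x : ℕ) (e : Term) (c : Prog) : Prog :=
  .seq (.assign x (.const 0))
    (.loop (.lt (.reg x) e) (.seq c (.assign x (.add (.reg x) (.const 1)))))

/-- The rule for counting loops: the invariant `Inv j` holds after `j` rounds. -/
theorem Reaches.forLoop {x : ℕ} {e : Term} {c : Prog} {S N : ℕ} {σ : State}
    {Inv : ℕ → State → Prop} (h0 : Inv 0 (σ.setReg x 0))
    (hreg : ∀ j τ, Inv j τ → τ.reg x = j ∧ e.eval τ = N)
    (hc : ∀ j < N, ∀ τ, Inv j τ →
      Reaches c S τ fun υ => υ.reg x = j ∧ Inv (j + 1) (υ.setReg x (j + 1))) :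
    Reaches (.forLoop x e c) (N * (S + 2) + 2) σ (Inv N) := by
  refine assign_seq (T := N * (S + 1 + 1) + 1) (mono (loop
    (Inv := fun m τ => ∃ j, j + m = N ∧ Inv j τ) ?_ N ⟨0, by omega, h0⟩) le_rfl ?_)
  · rintro m τ ⟨j, hj, hi⟩ he
    obtain ⟨hx, hN⟩ := hreg j τ hi
    have hjN : j < N := by
      by_contra hcon
      simp [Term.eval, hx, hN, hcon] at he
    refine seq (mono (hc j hjN τ hi) le_rfl ?_)
    rintro υ ⟨hυ, hi'⟩
    refine assign ⟨m - 1, by omega, j + 1, by omega, ?_⟩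
    simpa [Term.eval, hυ] using hi'
  · rintro τ ⟨⟨m, j, hj, hi⟩, he⟩
    obtain ⟨hx, hN⟩ := hreg j τ hi
    have : ¬ j < N := fun hcon => by simp [Term.eval, hx, hN, hcon] at he
    obtain rfl : j = N := by omega
    exact hi

/-- Fill the square with side `reg l` of the array `a` with the values of `e`, which may refer to
the indices as registers `x` and `y`. -/
def Prog.fill (a x y l : ℕ) (e : Term) : Prog :=
  .forLoop x (.reg l) (.forLoop y (.reg l) (.write a (.reg x) (.reg y) e))

/-- The rule for `Prog.fill`, for expressions `e` that do not depend on the array `a`. -/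
theorem Reaches.fill {a x y l : ℕ} {e : Term} {σ : State} (hxy : x ≠ y) (hxl : x ≠ l) (hyl : y ≠ l)
    (F : ℕ → ℕ → ℕ)
    (he : ∀ τ : State, (∀ b ≠ a, τ.arr b = σ.arr b) → (∀ r, r ≠ x → r ≠ y → τ.reg r = σ.reg r) →
      τ.reg x < σ.reg l → τ.reg y < σ.reg l → e.eval τ = F (τ.reg x) (τ.reg y)) :
    Reaches (.fill a x y l e) (σ.reg l * (σ.reg l * 3 + 4) + 2) σ fun τ =>
      (∀ b ≠ a, τ.arr b = σ.arr b) ∧ (∀ r, r ≠ x → r ≠ y → τ.reg r = σ.reg r) ∧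
      ∀ i < σ.reg l, ∀ j < σ.reg l, τ.arr a i j = F i j := by
  refine mono (forLoop (S := σ.reg l * 3 + 2) (N := σ.reg l) (Inv := fun i τ => τ.reg x = i ∧
    (∀ b ≠ a, τ.arr b = σ.arr b) ∧ (∀ r, r ≠ x → r ≠ y → τ.reg r = σ.reg r) ∧
      ∀ i' < i, ∀ j < σ.reg l, τ.arr a i' j = F i' j) ?_ ?_ ?_) le_rfl fun τ h => h.2
  · refine ⟨by simp, by simp, fun r hr _ => by simp [hr], fun i' h => by omega⟩
  · rintro i τ ⟨hx, -, hreg, -⟩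
    exact ⟨hx, hreg l hxl.symm hyl.symm⟩
  · rintro i hi τ ⟨hx, harr, hreg, hF⟩
    refine mono (forLoop (S := 1) (N := σ.reg l) (Inv := fun j υ => υ.reg y = j ∧ υ.reg x = i ∧
      (∀ b ≠ a, υ.arr b = σ.arr b) ∧ (∀ r, r ≠ x → r ≠ y → υ.reg r = σ.reg r) ∧
      (∀ i' < i, ∀ j < σ.reg l, υ.arr a i' j = F i' j) ∧ ∀ j' < j, υ.arr a i j' = F i j')
      ?_ ?_ ?_) le_rfl ?_
    · refine ⟨by simp, by simp [hxy, hx], by simpa using harr, fun r h1 h2 => ?_, hF,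
        fun j' h => by omega⟩
      simp [h2, hreg r h1 h2]
    · rintro j υ ⟨hy, -, -, hreg, -⟩
      exact ⟨hy, hreg l hxl.symm hyl.symm⟩
    · rintro j hj υ ⟨hy, hx, harr, hreg, hF, hF'⟩
      -- The value of `e` is not affected by the entries of `a` written so far.
      have hval : e.eval υ = F i j := by rw [he υ harr hreg (hx ▸ hi) (hy ▸ hj), hx, hy]
      refine write ⟨hy, by simp, by simp [hxy, hx], fun b hb => ?_, fun r h1 h2 => ?_, ?_, ?_⟩
      · simp [State.arr_setArr_of_ne _ hb, harr b hb]
      · simp [h2, hreg r h1 h2]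
      · intro i' hi' j' hj'
        simp [Term.eval, State.arr_setArr_self, hx, hi'.ne, hF i' hi' j' hj']
      · intro j' hj'
        simp only [Term.eval, State.arr_setReg, State.arr_setArr_self, hx, hy, true_and, hval]
        split_ifs with h
        · rw [h]
        · exact hF' j' (by omega)
    · rintro υ ⟨hy, hx, harr, hreg, hF, hF'⟩
      refine ⟨hx, by simp, by simpa using harr, fun r h1 h2 => by simp [h1, hreg r h1 h2], ?_⟩
      intro i' hi' j hj
      rcases Nat.lt_succ_iff_lt_or_eq.1 hi' with h | rfl
      · exact hF i' h j hj
      · exact hF' j hj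

end RAM

/-! ### The kernelization program -/

namespace RAM

/-- Registers: `0`, `1` hold `n`, `k`. Append to the terminal pairs in array `1` the reversed
pairs, so that the row `c - 1` belongs to slot number `c`, and mark the terminals in array `2`. -/
def prepareProg : Prog :=
  .forLoop 2 (.reg 1)
    (.seq (.write 1 (.add (.reg 1) (.reg 2)) (.const 0) (.read 1 (.reg 2) (.const 1)))
    (.seq (.write 1 (.add (.reg 1) (.reg 2)) (.const 1) (.read 1 (.reg 2) (.const 0)))
    (.seq (.write 2 (.read 1 (.reg 2) (.const 0)) (.const 0) (.const 1))
      (.write 2 (.read 1 (.reg 2) (.const 1)) (.const 0) (.const 1)))))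

/-- The terminal of the slot whose number is in register `4`. -/
def ownEnd : Term := .read 1 (.sub (.reg 4) (.const 1)) (.const 0)

/-- The other terminal of the pair of this slot. -/
def otherEnd : Term := .read 1 (.sub (.reg 4) (.const 1)) (.const 1)

/-- The test whether the vertex in register `3` serves the slot in register `4` and has a price
(in array `4`) below register `6`. -/
def offerTest : Term :=
  .eq (.const 0) (.add (.read 2 (.reg 3) (.const 0)) (.add
    (.sub (.const 1) (.read 0 ownEnd (.reg 3))) (.add
    (.sub (.read 0 ownEnd otherEnd) (.read 0 otherEnd (.reg 3)))
    (.sub (.const 1) (.lt (.read 4 (.reg 3) (.const 0)) (.reg 6))))))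

/-- The bound `2 * k + 1` on the prices. -/
def priceBound : Term := .add (.add (.reg 1) (.reg 1)) (.const 1)

/-- Find a cheapest vertex serving the slot in register `4`, provided that its price is below the
bound in register `6`; put the vertex into register `5` and its price into register `6`. -/
def searchProg : Prog :=
  .forLoop 3 (.reg 0)
    (.ite offerTest
      (.seq (.assign 5 (.reg 3)) (.assign 6 (.read 4 (.reg 3) (.const 0)))) .skip)

/-- One bid of the slot in register `4`, with the prices in array `4` and the owners in
array `5`. -/
def bidProg : Prog :=
  .seq (.assign 6 priceBound) (.seq searchProg
    (.ite (.lt (.reg 6) priceBound)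
      (.seq (.write 4 (.reg 5) (.const 0) (.add (.reg 6) (.const 1)))
      (.seq (.assign 7 (.read 5 (.reg 5) (.const 0)))
      (.seq (.write 5 (.reg 5) (.const 0) (.reg 4))
        (.assign 4 (.reg 7)))))
      (.assign 4 (.const 0))))

/-- The auction, where the slots enter one after the other. -/
def auctionProg : Prog :=
  .forLoop 8 (.add (.reg 1) (.reg 1))
    (.seq (.assign 4 (.add (.reg 8) (.const 1))) (.loop (.reg 4) bidProg))

/-- Enumerate the kept vertices in array `6`, with their positions in array `7` and their number
in register `7`. -/
def enumerateProg : Prog :=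
  .seq (.assign 7 (.const 0))
    (.forLoop 3 (.reg 0)
      (.ite (.add (.read 2 (.reg 3) (.const 0)) (.read 5 (.reg 3) (.const 0)))
        (.seq (.write 6 (.reg 7) (.const 0) (.reg 3))
        (.seq (.write 7 (.reg 3) (.const 0) (.reg 7))
          (.assign 7 (.add (.reg 7) (.const 1)))))
        .skip))

/-- Replace the instance by its restriction to the enumerated vertices. The new adjacency matrix is
first built in array `8`, since array `0` is still read. -/
def emitProg : Prog :=
  .seq (.fill 8 3 4 7 (.read 0 (.read 6 (.reg 3) (.const 0)) (.read 6 (.reg 4) (.const 0))))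
  (.seq (.fill 0 3 4 7 (.read 8 (.reg 3) (.reg 4)))
  (.seq (.assign 0 (.reg 7))
    (.forLoop 3 (.reg 1)
      (.seq (.write 1 (.reg 3) (.const 0) (.read 7 (.read 1 (.reg 3) (.const 0)) (.const 0)))
        (.write 1 (.reg 3) (.const 1) (.read 7 (.read 1 (.reg 3) (.const 1)) (.const 0)))))))

/-- The kernelization: keep the terminals and the vertices owned at the end of the auction. -/
def kernelProg : Prog := .seq prepareProg (.seq auctionProg (.seq enumerateProg emitProg))

end RAM

namespace VDPInstance

open RAM

theorem inputState_arr_zero_of_adj (I : VDPInstance) {u v : Fin I.n} (h : I.G.Adj u v) :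
    I.inputState.arr 0 u v = 1 := by
  simp [inputState, h]

theorem inputState_arr_zero_of_not_adj (I : VDPInstance) {u v : Fin I.n} (h : ¬ I.G.Adj u v) :
    I.inputState.arr 0 u v = 0 := by
  simp [inputState, h]

/-- The memory after `prepareProg`. -/
structure IsPrepared (I : VDPInstance) (σ : State) : Prop where
  n_eq : σ.reg 0 = I.n
  k_eq : σ.reg 1 = I.k
  adj : σ.arr 0 = I.inputState.arr 0
  own : ∀ c, σ.arr 1 (I.slotNumber c - 1) 0 = I.terminal c
  other : ∀ c, σ.arr 1 (I.slotNumber c - 1) 1 = I.terminal (c.1, !c.2)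
  mark : ∀ v : Fin I.n, I.IsTerminal v → σ.arr 2 v 0 = 1
  unmarked : ∀ v : Fin I.n, ¬ I.IsTerminal v → σ.arr 2 v 0 = 0

variable {I : VDPInstance} {σ : State}

theorem IsPrepared.congr (h : I.IsPrepared σ) {τ : State} (h0 : τ.reg 0 = σ.reg 0)
    (h1 : τ.reg 1 = σ.reg 1) (harr : ∀ a < 3, τ.arr a = σ.arr a) : I.IsPrepared τ where
  n_eq := h0.trans h.n_eq
  k_eq := h1.trans h.k_eq
  adj := (harr 0 (by omega)).trans h.adj
  own := harr 1 (by omega) ▸ h.own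
  other := harr 1 (by omega) ▸ h.other
  mark := harr 2 (by omega) ▸ h.mark
  unmarked := harr 2 (by omega) ▸ h.unmarked

theorem IsPrepared.setReg (h : I.IsPrepared σ) {x : ℕ} (hx : 2 ≤ x) (v : ℕ) :
    I.IsPrepared (σ.setReg x v) :=
  h.congr (by simp; omega) (by simp; omega) (by simp)

theorem IsPrepared.setArr (h : I.IsPrepared σ) {a : ℕ} (ha : 3 ≤ a) (i j v : ℕ) :
    I.IsPrepared (σ.setArr a i j v) :=
  h.congr rfl rfl fun _ hb => State.arr_setArr_of_ne _ (by omega) i j v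

theorem reaches_prepareProg (I : VDPInstance) :
    Reaches prepareProg (I.k * 6 + 2) I.inputState fun τ =>
      I.IsPrepared τ ∧ ∀ w, τ.arr 4 w 0 = 0 ∧ τ.arr 5 w 0 = 0 := by
  have hk : I.inputState.reg 1 = I.k := by simp [inputState]
  refine .mono (.forLoop (S := 4) (N := I.k) (Inv := fun j τ => τ.reg 2 = j ∧ τ.reg 0 = I.n ∧
    τ.reg 1 = I.k ∧ τ.arr 0 = I.inputState.arr 0 ∧ τ.arr 4 = I.inputState.arr 4 ∧
    τ.arr 5 = I.inputState.arr 5 ∧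
    (∀ i : Fin I.k, τ.arr 1 i 0 = I.s i ∧ τ.arr 1 i 1 = I.t i) ∧
    (∀ i : Fin I.k, (i : ℕ) < j → τ.arr 1 (I.k + i) 0 = I.t i ∧ τ.arr 1 (I.k + i) 1 = I.s i) ∧
    (∀ v : Fin I.n, (∃ i : Fin I.k, (i : ℕ) < j ∧ (I.s i = v ∨ I.t i = v)) → τ.arr 2 v 0 = 1) ∧
    (∀ v : Fin I.n, (¬ ∃ i : Fin I.k, (i : ℕ) < j ∧ (I.s i = v ∨ I.t i = v)) → τ.arr 2 v 0 = 0))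
    ?_ ?_ ?_) le_rfl ?_
  · simp [inputState]
  · rintro j τ ⟨h2, -, h1, -⟩
    exact ⟨h2, h1⟩
  · rintro j hj τ ⟨h2, h0, h1, hA, h4, h5, hE, hE', hM, hM'⟩
    obtain ⟨hs, ht⟩ := hE ⟨j, hj⟩
    simp only at hs ht
    have e1 : ¬ j = I.k + j := by omega
    refine .write_seq (.write_seq (.write_seq (.write ?_)))
    simp only [Term.eval, h2, h1, State.reg_setArr, State.arr_setReg, State.arr_setArr_self,
      State.arr_setArr_of_ne _ (show (1 : ℕ) ≠ 2 by decide), hs, ht, e1, false_and, if_false]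
    refine ⟨trivial, by simp, by simp [h0], by simp [h1], ?_, ?_, ?_, ?_, ?_, ?_, ?_⟩
    · simp [State.arr_setArr_of_ne, hA]
    · simp [State.arr_setArr_of_ne, h4]
    · simp [State.arr_setArr_of_ne, h5]
    · intro i
      have := i.2
      have e2 : ¬ (i : ℕ) = I.k + j := by omega
      simp [e2, hE i]
    · intro i hi
      by_cases e2 : (i : ℕ) = j
      · obtain rfl : i = ⟨j, hj⟩ := Fin.ext e2
        simp
      · simp [e2, hE' i (by omega)]
    · rintro v ⟨i, hi, hv⟩
      simp only [and_true]
      by_cases e2 : (i : ℕ) = j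
      · obtain rfl : i = ⟨j, hj⟩ := Fin.ext e2
        rcases hv with rfl | rfl <;> simp
      · simp [State.arr_setArr_of_ne, hM v ⟨i, by omega, hv⟩]
    · intro v hv
      have e2 : ¬ (v : ℕ) = I.s ⟨j, hj⟩ := fun h => hv ⟨⟨j, hj⟩, by simp, Or.inl (Fin.ext h.symm)⟩
      have e3 : ¬ (v : ℕ) = I.t ⟨j, hj⟩ := fun h => hv ⟨⟨j, hj⟩, by simp, Or.inr (Fin.ext h.symm)⟩
      simp only [and_true, e2, e3, if_false]
      rw [State.arr_setArr_of_ne _ (by decide), State.arr_setArr_of_ne _ (by decide)]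
      exact hM' v fun ⟨i, hi, h⟩ => hv ⟨i, by omega, h⟩
  · rintro τ ⟨-, h0, h1, hA, h4, h5, hE, hE', hM, hM'⟩
    refine ⟨⟨h0, h1, hA, ?_, ?_, ?_, ?_⟩, ?_⟩
    · rintro ⟨i, _ | _⟩
      · simpa [slotNumber, terminal] using (hE i).1
      · simpa [slotNumber, terminal] using (hE' i i.2).1
    · rintro ⟨i, _ | _⟩
      · simpa [slotNumber, terminal] using (hE i).2
      · simpa [slotNumber, terminal] using (hE' i i.2).2
    · rintro v ⟨⟨i, _ | _⟩, hv⟩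
      · exact hM v ⟨i, i.2, Or.inl hv⟩
      · exact hM v ⟨i, i.2, Or.inr hv⟩
    · rintro v hv
      refine hM' v ?_
      rintro ⟨i, -, rfl | rfl⟩
      · exact hv (I.isTerminal_s i)
      · exact hv (I.isTerminal_t i)
    · simp [h4, h5, inputState]

theorem IsPrepared.eval_offerTest (h : I.IsPrepared σ) (h0 : σ.reg 4 ≠ 0)
    (hle : σ.reg 4 ≤ I.k + I.k) (hw : σ.reg 3 < I.n) :
    offerTest.eval σ ≠ 0 ↔
      I.ServesNumber (σ.reg 4) (σ.reg 3) ∧ σ.arr 4 (σ.reg 3) 0 < σ.reg 6 := by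
  obtain ⟨c, hc⟩ := I.exists_slotNumber_eq (Nat.pos_of_ne_zero h0) hle
  obtain ⟨w, hw⟩ : ∃ w : Fin I.n, (w : ℕ) = σ.reg 3 := ⟨⟨_, hw⟩, rfl⟩
  have hserves : I.ServesNumber (σ.reg 4) (σ.reg 3) ↔ I.Serves c w := by
    rw [← hc, ← hw]
    constructor
    · rintro ⟨x, v, hx, hv, hxv⟩
      obtain rfl := I.slotNumber_injective hx
      obtain rfl := Fin.ext hv
      exact hxv
    · exact fun h => ⟨c, w, rfl, rfl, h⟩
  have hadj : I.G.Adj (I.terminal c) (I.terminal (c.1, !c.2)) ↔ I.G.Adj (I.s c.1) (I.t c.1) := by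
    obtain ⟨i, _ | _⟩ := c
    · rfl
    · exact I.G.adj_comm _ _
  rw [hserves]
  unfold Serves
  rw [← hadj]
  simp only [offerTest, ownEnd, otherEnd, Term.eval, ← hw, ← hc, h.own, h.other, h.adj]
  by_cases hT : I.IsTerminal w
  · simp [hT, h.mark w hT]
    omega
  · by_cases h1 : I.G.Adj (I.terminal c) w
    · by_cases h2 : I.G.Adj (I.terminal c) (I.terminal (c.1, !c.2))
      · by_cases h3 : I.G.Adj (I.terminal (c.1, !c.2)) w
        · simp [hT, h1, h2, h3, h.unmarked w hT, inputState_arr_zero_of_adj]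
          split_ifs with hlt <;> simp [hlt]
        · simp [h1, h2, h3, h.unmarked w hT, inputState_arr_zero_of_adj,
            inputState_arr_zero_of_not_adj]
          omega
      · simp [hT, h1, h2, h.unmarked w hT, inputState_arr_zero_of_adj,
          inputState_arr_zero_of_not_adj]
        split_ifs with hlt <;> simp [hlt]
    · simp [h1, inputState_arr_zero_of_not_adj]
      omega

/-- The memory holds a state of the auction with `q` slots. -/
def HoldsAuction (I : VDPInstance) (q : ℕ) (σ : State) : Prop :=
  I.IsPrepared σ ∧ Auction I.n (I.k + I.k + 1) I.ServesNumber q (σ.reg 4)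
    (fun w => σ.arr 4 w 0) (fun w => σ.arr 5 w 0)

theorem IsPrepared.reaches_searchProg (h : I.IsPrepared σ) (h0 : σ.reg 4 ≠ 0)
    (hle : σ.reg 4 ≤ I.k + I.k) :
    Reaches searchProg (I.n * 5 + 2) σ fun τ =>
      I.IsPrepared τ ∧ τ.arr = σ.arr ∧ τ.reg 4 = σ.reg 4 ∧ τ.reg 8 = σ.reg 8 ∧
      ((τ.reg 6 = σ.reg 6 ∧ ∀ w < I.n, I.ServesNumber (σ.reg 4) w → σ.reg 6 ≤ σ.arr 4 w 0) ∨
       (τ.reg 6 < σ.reg 6 ∧ τ.reg 5 < I.n ∧ I.ServesNumber (σ.reg 4) (τ.reg 5) ∧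
        τ.reg 6 = σ.arr 4 (τ.reg 5) 0 ∧
        ∀ w < I.n, I.ServesNumber (σ.reg 4) w → τ.reg 6 ≤ σ.arr 4 w 0)) := by
  refine .mono (.forLoop (S := 3) (N := I.n) (Inv := fun j τ => τ.reg 3 = j ∧
      I.IsPrepared τ ∧ τ.arr = σ.arr ∧ τ.reg 4 = σ.reg 4 ∧ τ.reg 8 = σ.reg 8 ∧
      ((τ.reg 6 = σ.reg 6 ∧ ∀ w < j, I.ServesNumber (σ.reg 4) w → σ.reg 6 ≤ σ.arr 4 w 0) ∨
       (τ.reg 6 < σ.reg 6 ∧ τ.reg 5 < I.n ∧ I.ServesNumber (σ.reg 4) (τ.reg 5) ∧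
        τ.reg 6 = σ.arr 4 (τ.reg 5) 0 ∧
        ∀ w < j, I.ServesNumber (σ.reg 4) w → τ.reg 6 ≤ σ.arr 4 w 0))) ?_ ?_ ?_) le_rfl
      fun τ h => h.2
  · exact ⟨by simp, h.setReg (by omega) _, by simp, by simp, by simp, Or.inl ⟨by simp, by simp⟩⟩
  · rintro j τ ⟨h3, hP, -⟩
    exact ⟨h3, hP.n_eq⟩
  · rintro j hj τ ⟨h3, hP, harr, h4, h8, hbest⟩
    have htest := hP.eval_offerTest (h4 ▸ h0) (h4 ▸ hle) (h3 ▸ hj)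
    rw [h3, h4, harr] at htest
    refine .ite (fun he => ?_) (fun he => ?_)
    · obtain ⟨hN, hlt⟩ := htest.1 he
      refine .assign_seq (.assign ⟨by simp [h3], by simp,
        ((hP.setReg (by omega) _).setReg (by omega) _).setReg (by omega) _, by simp [harr],
        by simp [h4], by simp [h8], Or.inr ?_⟩)
      simp only [Term.eval, State.reg_setReg, State.arr_setReg, h3, harr]
      simp only [Nat.reduceEqDiff, if_true, if_false]
      have hlt' : σ.arr 4 j 0 < σ.reg 6 := by
        rcases hbest with ⟨h6, -⟩ | ⟨h6, -⟩ <;> omega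
      refine ⟨hlt', hj, hN, trivial, fun w hw hNw => ?_⟩
      rcases Nat.lt_succ_iff_lt_or_eq.1 hw with hw | rfl
      · rcases hbest with ⟨h6, hb⟩ | ⟨h6, -, -, -, hb⟩
        · exact hlt'.le.trans (hb w hw hNw)
        · exact hlt.le.trans (hb w hw hNw)
      · exact le_rfl
    · refine .mono (.skip ?_) (show 1 ≤ 2 by omega) fun _ h => h
      refine ⟨h3, by simp, hP.setReg (by omega) _, by simp [harr], by simp [h4], by simp [h8], ?_⟩
      have hj' : I.ServesNumber (σ.reg 4) j → τ.reg 6 ≤ σ.arr 4 j 0 := fun hN => by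
        by_contra hcon
        exact htest.2 ⟨hN, by omega⟩ he
      simp only [State.reg_setReg]
      simp only [Nat.reduceEqDiff, if_false]
      rcases hbest with ⟨h6, hb⟩ | ⟨h6, h5, hN, hp, hb⟩
      · refine Or.inl ⟨h6, fun w hw hNw => ?_⟩
        rcases Nat.lt_succ_iff_lt_or_eq.1 hw with hw | rfl
        · exact hb w hw hNw
        · exact h6 ▸ hj' hNw
      · refine Or.inr ⟨h6, h5, hN, hp, fun w hw hNw => ?_⟩
        rcases Nat.lt_succ_iff_lt_or_eq.1 hw with hw | rfl
        · exact hb w hw hNw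
        · exact hj' hNw

/-- A bound on the number of the remaining bids of the slots that have entered the auction: each
bid increases the sum of the prices or retires a slot. -/
def bidsLeft (I : VDPInstance) (σ : State) : ℕ :=
  I.n * (I.k + I.k + 1) - ∑ w ∈ Finset.range I.n, σ.arr 4 w 0 + if σ.reg 4 = 0 then 0 else 1

theorem HoldsAuction.reaches_bidProg {q : ℕ} (h : I.HoldsAuction q σ) (hq : q ≤ I.k + I.k)
    (h0 : σ.reg 4 ≠ 0) :
    Reaches bidProg (I.n * 5 + 8) σ fun τ =>
      I.HoldsAuction q τ ∧ τ.reg 8 = σ.reg 8 ∧ I.bidsLeft τ < I.bidsLeft σ := by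
  obtain ⟨hP, hA⟩ := h
  have hbound : ∀ τ, I.IsPrepared τ → priceBound.eval τ = I.k + I.k + 1 := fun τ h => by
    simp [priceBound, Term.eval, h.k_eq]
  refine .assign_seq (T := I.n * 5 + 2 + 5) (.seq (.mono
    ((hP.setReg (x := 6) (by omega) _).reaches_searchProg ?_ ?_) le_rfl ?_))
  · simpa using h0
  · simpa using hA.hand_le.trans hq
  rw [hbound σ hP]
  simp only [State.reg_setReg, State.arr_setReg]
  simp only [Nat.reduceEqDiff, if_true, if_false]
  rintro τ ⟨hPτ, harr, h4, h8, hcases⟩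
  refine .ite (T := 4) (fun he => ?_) (fun he => ?_)
  · have hlt : τ.reg 6 < I.k + I.k + 1 := by
      by_contra hcon
      simp [Term.eval, hbound τ hPτ, hcon] at he
    rcases hcases with ⟨h6, -⟩ | ⟨-, h5, hN, hp, hmin⟩
    · omega
    have hprice : σ.arr 4 (τ.reg 5) 0 < I.k + I.k + 1 := hp ▸ hlt
    rw [hp] at hmin
    refine .write_seq (.assign_seq (.write_seq (.assign ?_)))
    have hA' := hA.bid (b := τ.reg 5) h0 h5 hN hprice hmin (fun _ => rfl) (fun _ => rfl)
    simp only [Term.eval, State.reg_setReg, State.reg_setArr,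
      State.arr_setArr_of_ne _ (show (5 : ℕ) ≠ 4 by decide), harr, h4, hp]
    simp only [Nat.reduceEqDiff, if_true, if_false]
    refine ⟨⟨?_, ?_⟩, by simp [h8], ?_⟩
    · exact (((hPτ.setArr (by omega) _ _ _).setReg (by omega) _).setArr (by omega) _ _ _).setReg
        (by omega) _
    · convert hA' using 1
      · simp
      · funext w
        simp [State.arr_setArr_of_ne, State.arr_setArr_self, harr]
      · funext w
        simp [State.arr_setArr_of_ne, State.arr_setArr_self, harr]
    · have hsum : ∑ w ∈ Finset.range I.n, (if w = τ.reg 5 then σ.arr 4 (τ.reg 5) 0 + 1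
          else σ.arr 4 w 0) = ∑ w ∈ Finset.range I.n, σ.arr 4 w 0 + 1 := by
        have : ∀ w, (if w = τ.reg 5 then σ.arr 4 (τ.reg 5) 0 + 1 else σ.arr 4 w 0) =
            σ.arr 4 w 0 + if w = τ.reg 5 then 1 else 0 := fun w => by
          split_ifs with h
          · rw [h]
          · rfl
        simp only [this, Finset.sum_add_distrib]
        simp [h5]
      -- The sum of the prices has grown by one and is still at most `n * (2 * k + 1)`, so the
      -- truncated difference in `bidsLeft` has really decreased.
      have hle := hA'.sum_price_le
      rw [hsum] at hle
      simp only [bidsLeft, State.reg_setReg, State.arr_setReg, State.arr_setArr_self, harr,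
        State.arr_setArr_of_ne _ (show (4 : ℕ) ≠ 5 by decide), and_true, hsum, h0, if_false]
      split_ifs <;> omega
  · have hge : ¬ τ.reg 6 < I.k + I.k + 1 := fun hcon => by
      simp [Term.eval, hbound τ hPτ, hcon] at he
    rcases hcases with ⟨h6, hmin⟩ | ⟨h6, -⟩
    · refine .mono (.assign ⟨⟨hPτ.setReg (by omega) _, ?_⟩, by simp [h8], ?_⟩)
        (show 1 ≤ 4 by omega) fun _ h => h
      · simpa [harr, Term.eval] using hA.retire hmin
      · simp [bidsLeft, harr, Term.eval, h0]
    · omega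

theorem IsPrepared.reaches_auctionProg (h : I.IsPrepared σ)
    (hzero : ∀ w, σ.arr 4 w 0 = 0 ∧ σ.arr 5 w 0 = 0) :
    Reaches auctionProg
      ((I.k + I.k) * ((I.n * (I.k + I.k + 1) + 1) * (I.n * 5 + 9) + 4) + 2) σ fun τ =>
      I.IsPrepared τ ∧ Auction I.n (I.k + I.k + 1) I.ServesNumber (I.k + I.k) 0
        (fun w => τ.arr 4 w 0) (fun w => τ.arr 5 w 0) := by
  refine .mono (.forLoop (S := (I.n * (I.k + I.k + 1) + 1) * (I.n * 5 + 9) + 2) (N := I.k + I.k)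
    (Inv := fun q τ => τ.reg 8 = q ∧ I.IsPrepared τ ∧
      Auction I.n (I.k + I.k + 1) I.ServesNumber q 0 (fun w => τ.arr 4 w 0) (fun w => τ.arr 5 w 0))
    ?_ ?_ ?_) le_rfl fun τ h => h.2
  · exact ⟨by simp, h.setReg (by omega) _, .init (fun w _ => (hzero w).1) fun w _ => (hzero w).2⟩
  · rintro q τ ⟨h8, hP, -⟩
    exact ⟨h8, by simp [Term.eval, hP.k_eq]⟩
  · rintro q hq τ ⟨h8, hP, hA⟩
    refine .assign_seq (.mono (.loop (S := I.n * 5 + 8) (m := I.n * (I.k + I.k + 1) + 1)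
      (Inv := fun m υ => υ.reg 8 = q ∧ I.HoldsAuction (q + 1) υ ∧ I.bidsLeft υ ≤ m) ?_ ?_)
      le_rfl ?_)
    · rintro m υ ⟨h8, hυ, hm⟩ he
      refine .mono (hυ.reaches_bidProg hq he) le_rfl ?_
      rintro υ' ⟨h, h8', hlt⟩
      exact ⟨_, hlt.trans_le hm, h8'.trans h8, h, le_rfl⟩
    · refine ⟨by simp [h8], ⟨hP.setReg (by omega) _, ?_⟩, ?_⟩
      · simpa [Term.eval, h8] using hA.enter
      · unfold bidsLeft
        split_ifs <;> omega
    · rintro υ ⟨⟨m, h8, ⟨hP, hA⟩, -⟩, he⟩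
      refine ⟨h8, by simp, hP.setReg (by omega) _, ?_⟩
      rw [show υ.reg 4 = 0 from he] at hA
      simpa using hA

/-- The memory after `enumerateProg`. -/
structure IsEnumerated (I : VDPInstance) (owner : ℕ → ℕ) (σ : State) : Prop where
  prepared : I.IsPrepared σ
  vertex : ∀ a < σ.reg 7, ∃ v ∈ I.kept owner, σ.arr 6 a 0 = v ∧ σ.arr 7 v 0 = a
  position : ∀ v ∈ I.kept owner, σ.arr 7 v 0 < σ.reg 7 ∧ σ.arr 6 (σ.arr 7 v 0) 0 = v

theorem IsPrepared.reaches_enumerateProg (h : I.IsPrepared σ) :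
    Reaches enumerateProg (I.n * 6 + 3) σ (I.IsEnumerated fun w => σ.arr 5 w 0) := by
  refine .assign_seq (.mono (.forLoop (S := 4) (N := I.n) (Inv := fun j τ => τ.reg 3 = j ∧
    I.IsPrepared τ ∧ τ.arr 5 = σ.arr 5 ∧
    (∀ a < τ.reg 7, ∃ v ∈ I.kept fun w => σ.arr 5 w 0, (v : ℕ) < j ∧ τ.arr 6 a 0 = v ∧
      τ.arr 7 v 0 = a) ∧
    (∀ v ∈ I.kept fun w => σ.arr 5 w 0, (v : ℕ) < j →
      τ.arr 7 v 0 < τ.reg 7 ∧ τ.arr 6 (τ.arr 7 v 0) 0 = v)) ?_ ?_ ?_) le_rfl ?_)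
  · exact ⟨by simp, (h.setReg (by omega) _).setReg (by omega) _, by simp, by simp [Term.eval],
      by simp⟩
  · rintro j τ ⟨h3, hP, -⟩
    exact ⟨h3, hP.n_eq⟩
  · rintro j hj τ ⟨h3, hP, h5, hv, hp⟩
    have htest : (⟨j, hj⟩ : Fin I.n) ∈ I.kept (fun w => σ.arr 5 w 0) ↔
        τ.arr 2 j 0 + τ.arr 5 j 0 ≠ 0 := by
      rw [h5]
      by_cases hT : I.IsTerminal ⟨j, hj⟩
      · simp [kept, hT, hP.mark _ hT]
      · have := hP.unmarked _ hT
        simp only at this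
        simp [kept, hT, this]
    refine .ite (fun he => ?_) (fun he => ?_)
    · have hkept := htest.2 (by simpa [Term.eval, h3] using he)
      refine .write_seq (.write_seq (.assign ⟨by simp [h3], by simp, ?_, ?_, ?_, ?_⟩))
      · exact (((hP.setArr (by omega) _ _ _).setArr (by omega) _ _ _).setReg (by omega) _).setReg
          (by omega) _
      · simp [State.arr_setArr_of_ne, h5]
      · intro a ha
        simp only [Term.eval, State.reg_setReg, State.reg_setArr] at ha
        simp only [Nat.reduceEqDiff, if_true, if_false] at ha
        simp only [Term.eval, State.arr_setReg, State.arr_setArr_self, State.reg_setArr, h3,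
          State.arr_setArr_of_ne _ (show (6 : ℕ) ≠ 7 by decide),
          State.arr_setArr_of_ne _ (show (7 : ℕ) ≠ 6 by decide), and_true]
        rcases Nat.lt_succ_iff_lt_or_eq.1 ha with ha | rfl
        · obtain ⟨v, hvk, hvj, hav, hva⟩ := hv a ha
          exact ⟨v, hvk, by omega, by rw [if_neg ha.ne, hav], by rw [if_neg hvj.ne, hva]⟩
        · exact ⟨⟨j, hj⟩, hkept, by simp, by simp, by simp⟩
      · intro v hvk hvj
        simp only [Term.eval, State.arr_setReg, State.arr_setArr_self, State.reg_setArr, h3,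
          State.reg_setReg,
          State.arr_setArr_of_ne _ (show (6 : ℕ) ≠ 7 by decide),
          State.arr_setArr_of_ne _ (show (7 : ℕ) ≠ 6 by decide), and_true]
        simp only [Nat.reduceEqDiff, if_true, if_false]
        by_cases hvj' : (v : ℕ) = j
        · simp [hvj']
        · obtain ⟨h1, h2⟩ := hp v hvk (by omega)
          rw [if_neg hvj', if_neg h1.ne]
          exact ⟨by omega, h2⟩
    · have hkept : (⟨j, hj⟩ : Fin I.n) ∉ I.kept (fun w => σ.arr 5 w 0) := fun hk =>
        htest.1 hk (by simpa [Term.eval, h3] using he)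
      refine .mono (.skip ?_) (show 1 ≤ 3 by omega) fun _ h => h
      refine ⟨h3, by simp, hP.setReg (by omega) _, h5, fun a ha => ?_, fun v hvk hvj => ?_⟩
      · obtain ⟨v, hvk, hvj, h⟩ := hv a (by simpa using ha)
        exact ⟨v, hvk, by omega, h⟩
      · have : (v : ℕ) ≠ j := fun h => hkept (by obtain rfl : v = ⟨j, hj⟩ := Fin.ext h; exact hvk)
        simpa using hp v hvk (by omega)
  · rintro τ ⟨-, hP, -, hv, hp⟩
    refine ⟨hP, fun a ha => ?_, fun v hv => hp v hv v.2⟩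
    obtain ⟨v, h1, -, h2⟩ := hv a ha
    exact ⟨v, h1, h2⟩

theorem IsPrepared.reaches_emitProg (h : I.IsPrepared σ) :
    Reaches emitProg (2 * (σ.reg 7 * (σ.reg 7 * 3 + 4) + 2) + (I.k * 4 + 3)) σ fun τ =>
      τ.reg 0 = σ.reg 7 ∧ τ.reg 1 = I.k ∧
      (∀ a < σ.reg 7, ∀ b < σ.reg 7,
        τ.arr 0 a b = I.inputState.arr 0 (σ.arr 6 a 0) (σ.arr 6 b 0)) ∧
      ∀ i : Fin I.k, τ.arr 1 i 0 = σ.arr 7 (I.s i) 0 ∧ τ.arr 1 i 1 = σ.arr 7 (I.t i) 0 := by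
  rw [two_mul, add_assoc]
  refine .seq (.mono (.fill (by decide) (by decide) (by decide)
    (fun a b => I.inputState.arr 0 (σ.arr 6 a 0) (σ.arr 6 b 0)) ?_) le_rfl ?_)
  · intro τ harr _ _ _
    simp [Term.eval, harr, h.adj]
  rintro τ ⟨harr, hreg, h8⟩
  have h7 : τ.reg 7 = σ.reg 7 := hreg 7 (by decide) (by decide)
  rw [← h7] at h8 ⊢
  refine .seq (.mono (.fill (by decide) (by decide) (by decide)
    (fun a b => I.inputState.arr 0 (σ.arr 6 a 0) (σ.arr 6 b 0)) ?_) le_rfl ?_)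
  · intro υ harr' _ hx hy
    simp only [Term.eval]
    rw [harr' 8 (by decide), h8 _ hx _ hy]
  rintro υ ⟨harr', hreg', h0⟩
  have h1 : υ.reg 1 = I.k := by
    rw [hreg' 1 (by decide) (by decide), hreg 1 (by decide) (by decide), h.k_eq]
  have hυ7 : υ.reg 7 = τ.reg 7 := hreg' 7 (by decide) (by decide)
  have hE : υ.arr 1 = σ.arr 1 := by rw [harr' 1 (by decide), harr 1 (by decide)]
  have hpos : υ.arr 7 = σ.arr 7 := by rw [harr' 7 (by decide), harr 7 (by decide)]
  refine .assign_seq (.mono (.forLoop (S := 2) (N := I.k) (Inv := fun j φ => φ.reg 3 = j ∧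
    φ.reg 0 = τ.reg 7 ∧ φ.reg 1 = I.k ∧ φ.arr 0 = υ.arr 0 ∧ φ.arr 7 = σ.arr 7 ∧
    (∀ i : Fin I.k, j ≤ i → φ.arr 1 i 0 = I.s i ∧ φ.arr 1 i 1 = I.t i) ∧
    ∀ i : Fin I.k, i < j → φ.arr 1 i 0 = σ.arr 7 (I.s i) 0 ∧ φ.arr 1 i 1 = σ.arr 7 (I.t i) 0)
    ?_ ?_ ?_) le_rfl ?_)
  · refine ⟨by simp, by simp [Term.eval, hυ7], by simp [h1], by simp, by simp [hpos],
      fun i _ => ?_, by simp⟩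
    have hs := h.own (i, false)
    have ht := h.other (i, false)
    simp only [slotNumber, terminal, Bool.false_eq_true, if_false, Bool.not_false, if_true,
      Nat.add_sub_cancel] at hs ht
    simp [hE, hs, ht]
  · rintro j φ ⟨h3, -, h1, -⟩
    exact ⟨h3, h1⟩
  · rintro j hj φ ⟨h3, hr0, hr1, ha0, ha7, hold, hnew⟩
    obtain ⟨hs, ht⟩ := hold ⟨j, hj⟩ le_rfl
    simp only at hs ht
    refine .write_seq (.write ⟨by simp [h3], by simp, by simp [hr0], by simp [hr1], ?_, ?_, ?_, ?_⟩)
    · simp [State.arr_setArr_of_ne, ha0]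
    · simp [State.arr_setArr_of_ne, ha7]
    · intro i hi
      have : ¬ (i : ℕ) = j := by omega
      simp [Term.eval, State.arr_setArr_self, h3, this, hold i (by omega)]
    · intro i hi
      by_cases hij : (i : ℕ) = j
      · obtain rfl : i = ⟨j, hj⟩ := Fin.ext hij
        simp [Term.eval, State.arr_setArr_self, State.arr_setArr_of_ne, h3, hs, ht, ha7]
      · simp [Term.eval, State.arr_setArr_self, h3, hij, hnew i (by omega)]
  · rintro φ ⟨-, hr0, hr1, ha0, -, -, hnew⟩
    refine ⟨hr0, hr1, fun a ha b hb => ?_, fun i => hnew i i.2⟩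
    rw [ha0]
    exact h0 a ha b hb

/-- The running time of the program in terms of `N = n + k`. -/
noncomputable def timeBound : Polynomial ℕ :=
  (.X * 6 + 2) + ((.X + .X) * ((.X * (.X + .X + 1) + 1) * (.X * 5 + 9) + 4) + 2 +
    (.X * 6 + 3 + (2 * (.X * (.X * 3 + 4) + 2) + (.X * 4 + 3))))

theorem exists_kernel (hG : IsSplitGraph I.G) :
    ∃ (J : VDPInstance) (σ : State) (T : ℕ),
      Runs kernelProg I.inputState σ T ∧ T ≤ timeBound.eval (I.n + I.k) ∧ J.IsOutput σ ∧
      IsSplitGraph J.G ∧ (I.IsYes ↔ J.IsYes) ∧ J.n ≤ 4 * I.k ∧ J.k ≤ I.k ∧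
      (I.G.Preconnected → J.G.Preconnected) := by
  obtain ⟨σ₁, t₁, hr₁, ht₁, hP₁, hzero⟩ := I.reaches_prepareProg
  obtain ⟨σ₂, t₂, hr₂, ht₂, hP₂, hA⟩ := hP₁.reaches_auctionProg hzero
  obtain ⟨σ₃, t₃, hr₃, ht₃, hP₃, hvertex, hposition⟩ := hP₂.reaches_enumerateProg
  obtain ⟨σ₄, t₄, hr₄, ht₄, h0, h1, hadj, hpairs⟩ := hP₃.reaches_emitProg
  have key : ∀ a : Fin (σ₃.reg 7), ∃ v ∈ I.kept fun w => σ₂.arr 5 w 0,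
      σ₃.arr 6 a 0 = v ∧ σ₃.arr 7 v 0 = a := fun a => hvertex a a.2
  choose o hkept ho hinv using key
  have hinj : Function.Injective o := fun a b hab => Fin.ext (by rw [← hinv a, ← hinv b, hab])
  have hsurj : ∀ v (hv : v ∈ I.kept fun w => σ₂.arr 5 w 0),
      o ⟨σ₃.arr 7 v 0, (hposition v hv).1⟩ = v := fun v hv =>
    Fin.ext (by rw [← ho, (hposition v hv).2])
  have hrange : Set.range o = I.kept fun w => σ₂.arr 5 w 0 := by
    ext v
    exact ⟨by rintro ⟨a, rfl⟩; exact hkept a, fun hv => ⟨_, hsurj v hv⟩⟩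
  have hm : σ₃.reg 7 ≤ I.n := by simpa using Fintype.card_le_of_injective o hinj
  refine ⟨I.restrict o (fun i => ⟨_, (hposition (I.s i) (Or.inl (I.isTerminal_s i))).1⟩)
    (fun i => ⟨_, (hposition (I.t i) (Or.inl (I.isTerminal_t i))).1⟩)
    (fun i => hsurj _ (Or.inl (I.isTerminal_s i)))
    (fun i => hsurj _ (Or.inl (I.isTerminal_t i))),
    σ₄, t₁ + (t₂ + (t₃ + t₄)), .seq hr₁ (.seq hr₂ (.seq hr₃ hr₄)), ?_,
    ⟨h0, h1, fun u v => ?_, hpairs⟩, hG.comap hinj, isYes_restrict_iff hG hinj _ _ ?_,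
    card_le_of_range_eq_kept hA hinj hrange, le_rfl, fun hconn => ?_⟩
  · refine (Nat.add_le_add ht₁ (Nat.add_le_add ht₂ (Nat.add_le_add ht₃ ht₄))).trans ?_
    have hn : I.n ≤ I.n + I.k := Nat.le_add_right _ _
    have hk : I.k ≤ I.n + I.k := Nat.le_add_left _ _
    have hm' := hm.trans hn
    simp only [timeBound, Polynomial.eval_add, Polynomial.eval_mul, Polynomial.eval_X,
      Polynomial.eval_ofNat, Polynomial.eval_one]
    gcongr
  · have := hadj u u.2 v v.2
    rw [ho u, ho v] at this
    rw [this]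
    exact ⟨fun h => I.inputState_arr_zero_of_adj h, fun h => I.inputState_arr_zero_of_not_adj h⟩
  · rw [hrange]
    exact suffices_kept hA
  · refine (hG.comap hinj).preconnected fun a => ?_
    obtain ⟨w, hw, haw⟩ := exists_kept_adj hA hconn (hkept a)
    refine ⟨⟨_, (hposition w hw).1⟩, ?_⟩
    change I.G.Adj (o a) (o _)
    rw [hsurj w hw]
    exact haw

end VDPInstance

/-- Vertex-Disjoint Paths on split graphs has a kernel with at most `4 * k` vertices: a program
that in polynomially many steps turns every instance `I` on a split graph into an equivalent
instance `J` on a split graph that has at most `4 * I.k` vertices and at most `I.k` terminal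
pairs. If the input graph is connected, then so is the output graph. -/
theorem theorem7 :
    ∃ (prog : RAM.Prog) (p : Polynomial ℕ), ∀ I : VDPInstance, IsSplitGraph I.G →
      ∃ (J : VDPInstance) (σ : RAM.State) (T : ℕ),
        RAM.Runs prog I.inputState σ T ∧ T ≤ p.eval (I.n + I.k) ∧ J.IsOutput σ ∧
        IsSplitGraph J.G ∧
        (I.IsYes ↔ J.IsYes) ∧
        J.n ≤ 4 * I.k ∧
        J.k ≤ I.k ∧
        (I.G.Preconnected → J.G.Preconnected) := by
  exact ⟨RAM.kernelProg, VDPInstance.timeBound, fun _ hG => VDPInstance.exists_kernel hG⟩
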